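/- **Model.** Consider $n$ point robots in the Euclidean plane $\mathbb{R}^2$ that are anonymous, identical, deterministic, oblivious (no memory) and unable to communicate. Time proceeds in fully synchronous look–compute–move cycles. In each cycle, every robot observes the positions of all robots at distance at most $1$ from it, in its own coordinate system, and moves to a point that it computes from this observation alone and that lies at distance at most $1$ from its current position. The local coordinate systems are centered at the robots and share the unit of length and the orientation (chirality) of the plane, but their axes may be rotated arbitrarily, differently for different robots and different cycles. A *protocol* is the common function that maps observations to target points. **Patterns.** A pattern is a finite non-empty set $P\subset\mathbb{R}^2$. It is *connected* if the graph on $P$ that joins two distinct points whenever their distance is at most $1$ is connected. The *symmetricity* $\operatorname{sym}(X)$ of a finite non-empty set $X\subset\mathbb{R}^2$ is the largest integer $m\ge 1$ such that $X$ can be partitioned into regular $m$-gons that all have their center at the center of the smallest enclosing circle of $X$; here a $2$-gon is a pair of distinct points with midpoint at the center, and a $1$-gon is any single point. A *near-gathering* is a placement of the robots at pairwise distinct positions such that the set of positions has diameter at most $1$. A pattern $P$ *can be formed* if there is a protocol (which may depend on $P$) such that, for every near-gathering $I$ of $|P|$ robots with $\operatorname{sym}(I)\mid\operatorname{sym}(P)$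 and for all choices of the rotations of the local coordinate systems, the robots starting in $I$ and executing the protocol reach after finitely many cycles a configuration whose set of positions is the image of $P$ under an orientation-preserving isometry of the plane (so $P$ is not scaled), and from then on never move again. **Lemma.** Let $P$ be a connected pattern whose symmetricity satisfies $\operatorname{sym}(P)\ge |P|/2$. Then $P$ can be formed. -/

import Mathlib

/-!
Oblivious mobile robots with limited visibility in the plane, and pattern formation.
The Euclidean plane is `ℂ`, so that rotations are multiplications by unit complex numbers.
-/

noncomputable section

namespace PatternFormation

/-- `c` is the center of the smallest circle that encloses `P`. -/
def IsSmallestEnclosingCenter (P : Set ℂ) (c : ℂ) : Prop :=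
  ∃ r : ℝ, P ⊆ Metric.closedBall c r ∧
    ∀ (c' : ℂ) (r' : ℝ), P ⊆ Metric.closedBall c' r' → r ≤ r'

/-- `S` is the vertex set of a regular `m`-gon with center `c` and positive circumradius
(a 2-gon is a pair of points with midpoint `c`); a 1-gon is any single point. -/
def IsRegularGon (m : ℕ) (c : ℂ) (S : Set ℂ) : Prop :=
  ∃ z : ℂ, (z ≠ 0 ∨ m = 1) ∧
    S = Set.range fun k : Fin m =>
      c + z * Complex.exp (2 * Real.pi * Complex.I * ((k : ℕ) : ℂ) / (m : ℂ))

/-- `P` can be partitioned into regular `m`-gons, all centered at the center of the smallest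
enclosing circle of `P`. -/
def HasRegularPartition (m : ℕ) (P : Finset ℂ) : Prop :=
  ∃ c : ℂ, IsSmallestEnclosingCenter (P : Set ℂ) c ∧
    ∃ parts : Finpartition P, ∀ S ∈ parts.parts, IsRegularGon m c (S : Set ℂ)

/-- The symmetricity of a finite set of points: the largest `m ≥ 1` for which the set has a
partition into regular `m`-gons around the center of its smallest enclosing circle. -/
def symmetricity (P : Finset ℂ) : ℕ :=
  sSup {m : ℕ | 1 ≤ m ∧ HasRegularPartition m P}

/-- The unit disc graph on the points of a pattern: two distinct points are adjacent if their
distance is at most `1`. -/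
def unitDiscGraph (P : Finset ℂ) : SimpleGraph P where
  Adj p q := p ≠ q ∧ dist (p : ℂ) (q : ℂ) ≤ 1
  symm := ⟨fun _ _ h => ⟨h.1.symm, by rw [dist_comm]; exact h.2⟩⟩
  loopless := ⟨fun _ h => h.1 rfl⟩

/-- A configuration of `n` robots: the positions of the robots in the plane. The names `Fin n`
are used only for bookkeeping and are not visible to the robots. -/
abbrev Configuration (n : ℕ) : Type := Fin n → ℂ

/-- The symmetricity of the set of robot positions. -/
def Configuration.sym {n : ℕ} (p : Configuration n) : ℕ :=
  symmetricity (Finset.univ.image p)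

/-- A near-gathering: the robots are at pairwise distinct positions, in a set of diameter at
most `1`. -/
def IsNearGathering {n : ℕ} (p : Configuration n) : Prop :=
  Function.Injective p ∧ ∀ i j, dist (p i) (p j) ≤ 1

/-- A deterministic protocol of identical oblivious robots: a function that maps what a robot
currently sees (a set of positions in its own coordinate system, in which it is itself at the
origin) to the point, in the same coordinate system, to which the robot moves. A robot moves
by a distance of at most `1` in one cycle. -/
structure Protocol where
  target : Set ℂ → ℂ
  norm_target_le : ∀ V : Set ℂ, ‖target V‖ ≤ 1

/-- What robot `i` sees in configuration `p` if the axes of its coordinate system are rotated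
by `u`: the positions `z`, in local coordinates, of all robots (itself included) at distance
at most `1`. The point with local coordinate `z` is `p i + u * z`: the coordinate systems are
centered at the robot and share the unit of length and the orientation of the plane. -/
def snapshot {n : ℕ} (p : Configuration n) (u : Circle) (i : Fin n) : Set ℂ :=
  {z : ℂ | ∃ j : Fin n, dist (p j) (p i) ≤ 1 ∧ p i + (u : ℂ) * z = p j}

/-- One fully synchronous look-compute-move cycle; `u i` is the rotation of the coordinate
system of robot `i` in this cycle. -/
def Protocol.step (A : Protocol) {n : ℕ} (u : Fin n → Circle) (p : Configuration n) :
    Configuration n :=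
  fun i => p i + (u i : ℂ) * A.target (snapshot p (u i) i)

/-- The configuration after `t` cycles, starting in `p`; `u t i` is the rotation of the
coordinate system of robot `i` in cycle `t`. -/
def Protocol.run (A : Protocol) {n : ℕ} (u : ℕ → Fin n → Circle) (p : Configuration n) :
    ℕ → Configuration n
  | 0 => p
  | t + 1 => A.step (u t) (Protocol.run A u p t)

/-- The robots stand on a copy of `P` under an orientation-preserving isometry of the plane
(no scaling). -/
def IsPattern {n : ℕ} (P : Finset ℂ) (p : Configuration n) : Prop :=
  ∃ (a : Circle) (b : ℂ), Set.range p = (fun z : ℂ => (a : ℂ) * z + b) '' (P : Set ℂ)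

/-- Whatever the coordinate systems of the robots are, the protocol leads from `p` to a
configuration that is a copy of `P`, in which the robots then remain forever. -/
def Protocol.Forms (A : Protocol) {n : ℕ} (P : Finset ℂ) (p : Configuration n) : Prop :=
  ∀ u : ℕ → Fin n → Circle, ∃ T : ℕ,
    IsPattern P (A.run u p T) ∧ ∀ t, T ≤ t → A.run u p t = A.run u p T

/-- The pattern `P` can be formed: one protocol (which may depend on `P`) forms `P` with
`|P|` robots from every near-gathering whose symmetricity divides that of `P`. -/
def CanBeFormed (P : Finset ℂ) : Prop :=
  ∃ A : Protocol, ∀ p : Configuration P.card,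
    IsNearGathering p → p.sym ∣ symmetricity P → A.Forms P p

end PatternFormation

end

noncomputable section

namespace PatternFormation

open scoped Pointwise
open Polynomial (nthRootsFinset)

/-! Idea of the proof. Let m be the symmetricity of P. Apart from the one-point pattern, the
hypothesis makes m ≥ 2 and P a union of one or two regular m-gons with a common center
(`exists_orbits`). The robots first form a tiny configuration with m-fold symmetry and then expand
it to P.

Expansion. An `ExpansionPlan` is a sequence of configurations, level 0 being a translate of P; a
robot that recognizes its level and role from its view moves to its place in the next lower level.
Here level k + 1 consists of the m-gons through the points c * q^k * b s, where b perturbs the base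
points of P. The distance to the nearest neighbor reveals the level once c and q avoid countably
many values (`canBeFormed_of_generic`). Within a level above 0, views must tell the gons apart and
have no rotational symmetry. For two gons of different radii, comparing number, second moment and
vector sum of the visible points separates the views (`false_of_matching_views`); a slight scaling
of one gon makes the radii differ and makes every relevant vector sum nonzero
(`exists_unbalanced_scaling`). Level 0 needs no such distinction, since nobody moves there.

Gathering. In a near-gathering everybody sees everything. If the centroid is unoccupied, the order
of the rotation group about it divides the symmetricity (`card_stabilizer_dvd_symmetricity`), hence
m, so there is a rotation-equivariant bijection onto a small level of the plan
(`exists_equivariant_assignment`), reached in one cycle. If a robot occupies the centroid, it first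
steps aside, which destroys all rotational symmetry. `canBeFormed_of_plan` combines both phases. -/

/-! ### Roots of unity and rotation-equivariant bijections -/

theorem mem_roots {d : ℕ} (hd : 0 < d) {w : ℂ} : w ∈ nthRootsFinset d (1 : ℂ) ↔ w ^ d = 1 :=
  Polynomial.mem_nthRootsFinset hd 1

theorem card_roots {d : ℕ} (hd : 0 < d) : (nthRootsFinset d (1 : ℂ)).card = d :=
  (Complex.isPrimitiveRoot_exp d hd.ne').card_nthRootsFinset

theorem norm_of_pow_eq_one {d : ℕ} (hd : 0 < d) {w : ℂ} (hw : w ^ d = 1) : ‖w‖ = 1 :=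
  Complex.norm_eq_one_of_pow_eq_one hw hd.ne'

/-- The fibers of `x ↦ x ^ d` on a set that is invariant under the `d`-th roots of unity. -/
theorem filter_pow_eq {X : Finset ℂ} {d : ℕ} (hd : 0 < d) (h0 : (0 : ℂ) ∉ X)
    (hX : ∀ w : ℂ, w ^ d = 1 → ∀ x ∈ X, w * x ∈ X) {x : ℂ} (hx : x ∈ X) :
    (X.filter fun y => y ^ d = x ^ d) = (nthRootsFinset d (1 : ℂ)).image (· * x) := by
  have hx0 : x ≠ 0 := fun h => h0 (h ▸ hx)
  ext y
  simp only [Finset.mem_filter, Finset.mem_image, mem_roots hd]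
  constructor
  · rintro ⟨-, h⟩
    refine ⟨y / x, ?_, div_mul_cancel₀ _ hx0⟩
    rw [div_pow, h, div_self (pow_ne_zero _ hx0)]
  · rintro ⟨w, hw, rfl⟩
    exact ⟨hX w hw x hx, by rw [mul_pow, hw, one_mul]⟩

theorem card_image_pow_mul {X : Finset ℂ} {d : ℕ} (hd : 0 < d) (h0 : (0 : ℂ) ∉ X)
    (hX : ∀ w : ℂ, w ^ d = 1 → ∀ x ∈ X, w * x ∈ X) :
    (X.image (· ^ d)).card * d = X.card := by
  rw [Finset.card_eq_sum_card_image (· ^ d) X, Finset.sum_const_nat]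
  intro y hy
  obtain ⟨x, hx, rfl⟩ := Finset.mem_image.1 hy
  have hx0 : x ≠ 0 := fun h => h0 (h ▸ hx)
  rw [filter_pow_eq hd h0 hX hx, Finset.card_image_of_injective _ (mul_left_injective₀ hx0),
    card_roots hd]

/-- Two finite sets of the same size on which the `d`-th roots of unity act freely are
equivariantly equivalent. -/
theorem exists_equivariant_map {X Y : Finset ℂ} {d : ℕ} (hd : 0 < d) (hXY : X.card = Y.card)
    (hX0 : (0 : ℂ) ∉ X) (hY0 : (0 : ℂ) ∉ Y)
    (hX : ∀ w : ℂ, w ^ d = 1 → ∀ x ∈ X, w * x ∈ X)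
    (hY : ∀ w : ℂ, w ^ d = 1 → ∀ x ∈ Y, w * x ∈ Y) :
    ∃ f : ℂ → ℂ, (∀ w : ℂ, w ^ d = 1 → ∀ x, f (w * x) = w * f x) ∧ f '' X = Y := by
  have hc : (X.image (· ^ d)).card = (Y.image (· ^ d)).card := by
    have h1 := card_image_pow_mul hd hX0 hX
    have h2 := card_image_pow_mul hd hY0 hY
    exact Nat.eq_of_mul_eq_mul_right hd (by rw [h1, h2, hXY])
  let e := Finset.equivOfCardEq hc
  have hr : ∀ y : ℂ, ∃ x : ℂ, y ∈ X.image (· ^ d) → x ∈ X ∧ x ^ d = y := by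
    intro y
    by_cases hy : y ∈ X.image (· ^ d)
    · obtain ⟨x, hx, h⟩ := Finset.mem_image.1 hy
      exact ⟨x, fun _ => ⟨hx, h⟩⟩
    · exact ⟨0, fun h => absurd h hy⟩
  choose r hr using hr
  have hs : ∀ y : ℂ, ∃ x : ℂ, ∀ h : y ∈ X.image (· ^ d), x ∈ Y ∧ x ^ d = (e ⟨y, h⟩ : ℂ) := by
    intro y
    by_cases hy : y ∈ X.image (· ^ d)
    · obtain ⟨x, hx, h⟩ := Finset.mem_image.1 (e ⟨y, hy⟩).2
      exact ⟨x, fun _ => ⟨hx, h⟩⟩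
    · exact ⟨0, fun h => absurd h hy⟩
  choose s hs using hs
  have hmem : ∀ x ∈ X, x ^ d ∈ X.image (· ^ d) := fun x hx => Finset.mem_image_of_mem _ hx
  have hr0 : ∀ x ∈ X, r (x ^ d) ≠ 0 := fun x hx h => hX0 (h ▸ (hr _ (hmem x hx)).1)
  have hroot : ∀ x ∈ X, (x / r (x ^ d)) ^ d = 1 := by
    intro x hx
    rw [div_pow, (hr _ (hmem x hx)).2]
    exact div_self (pow_ne_zero _ fun h => hX0 (h ▸ hx))
  -- Orbits are the fibers of `x ↦ x ^ d`. Here `r` picks a base point in each orbit of `X` and `s`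
  -- one in the matched orbit of `Y`; the root of unity that leads from the base point to `x` is
  -- carried over.
  refine ⟨fun x => x / r (x ^ d) * s (x ^ d), ?_, ?_⟩
  · intro w hw x
    simp only [mul_pow, hw, one_mul]
    ring
  · have hmaps : ∀ x ∈ X, x / r (x ^ d) * s (x ^ d) ∈ Y := fun x hx =>
      hY _ (hroot x hx) _ (hs _ (hmem x hx)).1
    have hinj : Set.InjOn (fun x => x / r (x ^ d) * s (x ^ d)) (X : Set ℂ) := by
      intro x hx y hy hxy
      simp only at hxy
      have h1 := congrArg (· ^ d) hxy
      simp only [mul_pow, hroot x hx, hroot y hy, one_mul, (hs _ (hmem x hx)).2,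
        (hs _ (hmem y hy)).2] at h1
      have h2 : x ^ d = y ^ d := by simpa using e.injective (Subtype.ext h1)
      rw [h2] at hxy
      have hsy : s (y ^ d) ≠ 0 := fun h => hY0 (h ▸ (hs _ (hmem y hy)).1)
      have h3 := mul_right_cancel₀ hsy hxy
      exact (div_left_inj' (hr0 y hy)).1 h3
    have : X.image (fun x => x / r (x ^ d) * s (x ^ d)) = Y := by
      apply Finset.eq_of_subset_of_card_le
      · intro y hy
        obtain ⟨x, hx, rfl⟩ := Finset.mem_image.1 hy
        exact hmaps x hx
      · rw [Finset.card_image_of_injOn hinj, hXY]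
    rw [← this, Finset.coe_image]

/-- The rotations that preserve a finite non-empty set without the origin are roots of unity. -/
theorem exists_mem_stabilizer_iff {X : Finset ℂ} (hX : X.Nonempty) (h0 : (0 : ℂ) ∉ X) :
    0 < Nat.card (MulAction.stabilizer Circle (X : Set ℂ)) ∧ ∀ w : ℂ,
      w ^ Nat.card (MulAction.stabilizer Circle (X : Set ℂ)) = 1 ↔
        ∃ u ∈ MulAction.stabilizer Circle (X : Set ℂ), (u : ℂ) = w := by
  obtain ⟨x, hx⟩ := hX
  have hx0 : x ≠ 0 := fun h => h0 (h ▸ hx)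
  set G := MulAction.stabilizer Circle (X : Set ℂ)
  have hG : ∀ u ∈ G, ∀ y ∈ X, (u : ℂ) * y ∈ X := by
    intro u hu y hy
    have h1 : u • (X : Set ℂ) = X := hu
    have h2 : u • y ∈ u • (X : Set ℂ) := Set.smul_mem_smul_set hy
    rw [h1] at h2
    exact h2
  have hfin : Finite G := by
    refine Finite.of_injective (fun u : G => (⟨(u : Circle) * x, hG u u.2 x hx⟩ : X)) ?_
    intro u v huv
    have := mul_right_cancel₀ hx0 (congrArg Subtype.val huv)
    exact Subtype.ext (Circle.ext this)
  have := Fintype.ofFinite G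
  have hpos : 0 < Nat.card G := Nat.card_pos
  refine ⟨hpos, ?_⟩
  have hinj : Function.Injective fun u : G => ((u : Circle) : ℂ) := fun u v h =>
    Subtype.ext (Circle.ext h)
  -- By Lagrange the group embeds into the roots of unity of order |G|; there are only |G| of these,
  -- so it is all of them.
  have hsub : Finset.univ.image (fun u : G => ((u : Circle) : ℂ)) =
      nthRootsFinset (Nat.card G) (1 : ℂ) := by
    apply Finset.eq_of_subset_of_card_le
    · intro w hw
      obtain ⟨u, -, rfl⟩ := Finset.mem_image.1 hw
      rw [mem_roots hpos, ← Circle.coe_pow, ← Subgroup.coe_pow, pow_card_eq_one']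
      simp
    · rw [card_roots hpos, Finset.card_image_of_injective _ hinj, Finset.card_univ,
        Nat.card_eq_fintype_card]
  intro w
  rw [← mem_roots hpos, ← hsub]
  simp

/-- A map that chooses, equivariantly under rotations, for every set of `n` points which does
not contain the origin and the order of whose rotation group divides `m`, a bijection with a
rotated copy of `Y`. -/
theorem exists_equivariant_assignment {n m : ℕ} (hn : 0 < n) {Y : Finset ℂ} (hYn : Y.card = n)
    (hY0 : (0 : ℂ) ∉ Y) (hY : ∀ w : ℂ, w ^ m = 1 → ∀ x ∈ Y, w * x ∈ Y) :
    ∃ F : Set ℂ → ℂ → ℂ, ∀ X : Finset ℂ, X.card = n → (0 : ℂ) ∉ X →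
      Nat.card (MulAction.stabilizer Circle (X : Set ℂ)) ∣ m →
      (∀ (u : Circle) (x : ℂ), F (u • (X : Set ℂ)) (u * x) = u * F X x) ∧
      ∃ v : Circle, F X '' X = v • (Y : Set ℂ) := by
  have key : ∀ R : Set ℂ, ∃ f : ℂ → ℂ, ∀ X : Finset ℂ, (X : Set ℂ) = R → X.card = n →
      (0 : ℂ) ∉ X → Nat.card (MulAction.stabilizer Circle R) ∣ m →
      (∀ u : Circle, u • R = R → ∀ x, f (u * x) = u * f x) ∧ f '' R = Y := by
    intro R
    by_cases h : ∃ X : Finset ℂ, (X : Set ℂ) = R ∧ X.card = n ∧ (0 : ℂ) ∉ X ∧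
      Nat.card (MulAction.stabilizer Circle R) ∣ m
    · obtain ⟨X, rfl, hXn, hX0, hd⟩ := h
      have hne : X.Nonempty := Finset.card_pos.1 (hXn ▸ hn)
      obtain ⟨hpos, hst⟩ := exists_mem_stabilizer_iff hne hX0
      obtain ⟨f, hf, hfX⟩ := exists_equivariant_map hpos (hXn.trans hYn.symm) hX0 hY0
        (by
          intro w hw x hx
          obtain ⟨u, hu, rfl⟩ := (hst w).1 hw
          have h1 : u • (X : Set ℂ) = X := hu
          have h2 : u • x ∈ u • (X : Set ℂ) := Set.smul_mem_smul_set hx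
          rw [h1] at h2
          exact h2)
        (by
          intro w hw x hx
          obtain ⟨k, hk⟩ := hd
          exact hY w (by rw [hk, pow_mul, hw, one_pow]) x hx)
      refine ⟨f, fun X' hX' _ _ _ => ⟨fun u hu x => hf u ((hst u).2 ⟨u, hu, rfl⟩) x, hfX⟩⟩
    · exact ⟨id, fun X h1 h2 h3 h4 => absurd ⟨X, h1, h2, h3, h4⟩ h⟩
  choose f hf using key
  -- A bijection is fixed on one representative of each rotation class of sets and transported to
  -- the others by the rotation `a X`.
  let rep : Set ℂ → Set ℂ := fun X =>
    Quotient.out (s := MulAction.orbitRel Circle (Set ℂ)) (Quotient.mk _ X)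
  have hrep : ∀ X, ∃ u : Circle, u • rep X = X := by
    intro X
    have h : MulAction.orbitRel Circle (Set ℂ) (rep X) X :=
      Quotient.mk_out (s := MulAction.orbitRel Circle (Set ℂ)) X
    exact MulAction.orbitRel_apply.1 ((MulAction.orbitRel Circle (Set ℂ)).symm h)
  choose a ha using hrep
  refine ⟨fun X x => a X * f (rep X) ((a X)⁻¹ * x), ?_⟩
  intro X hXn hX0 hd
  have hR : rep X = (a X)⁻¹ • (X : Set ℂ) := by rw [eq_inv_smul_iff, ha]
  obtain ⟨hf1, hf2⟩ := hf (rep X) (X.image fun x => ((a X)⁻¹ : Circle) * x)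
    (by rw [hR, Finset.coe_image]; rfl)
    (by
      rw [Finset.card_image_of_injective _ (mul_right_injective₀ (Circle.coe_ne_zero _)), hXn])
    (by simpa using hX0)
    (by
      rw [hR, MulAction.stabilizer_smul_eq_stabilizer_map_conj]
      rwa [Nat.card_congr (Subgroup.equivMapOfInjective _ _
        (MulAut.conj (a X : Circle)⁻¹).injective).symm.toEquiv])
  constructor
  · intro u x
    have hru : rep (u • (X : Set ℂ)) = rep X := by
      have : (Quotient.mk (MulAction.orbitRel Circle (Set ℂ)) (u • (X : Set ℂ))) =
          Quotient.mk _ (X : Set ℂ) := Quotient.sound ⟨u, rfl⟩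
      simp only [rep, this]
    have hau := ha (u • (X : Set ℂ))
    rw [hru] at hau
    -- Two ways of rotating the representative onto a set differ by an element of its stabilizer,
    -- under which `f` is equivariant; so the choice of `a` does not matter.
    have hst : ((a (u • (X : Set ℂ)))⁻¹ * u * a X) • rep X = rep X := by
      rw [mul_smul, mul_smul, ha X, inv_smul_eq_iff, hau]
    have h := hf1 _ hst (((a X)⁻¹ : Circle) * x)
    simp only [hru]
    have e1 : (((a (u • (X : Set ℂ)))⁻¹ : Circle) : ℂ) * (u * x) =
        (((a (u • (X : Set ℂ)))⁻¹ * u * a X : Circle) : ℂ) * (((a X)⁻¹ : Circle) * x) := by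
      push_cast
      have := Circle.coe_ne_zero (a X)
      field_simp
    rw [e1, h]
    push_cast
    have := Circle.coe_ne_zero (a (u • (X : Set ℂ)))
    field_simp
  · refine ⟨a X, ?_⟩
    rw [← hf2]
    ext y
    simp only [Set.mem_image]
    constructor
    · rintro ⟨x, hx, rfl⟩
      refine ⟨_, ⟨_, ?_, rfl⟩, rfl⟩
      rw [hR]
      exact ⟨x, hx, rfl⟩
    · rintro ⟨_, ⟨z, hz, rfl⟩, rfl⟩
      rw [hR] at hz
      obtain ⟨x, hx, rfl⟩ := hz
      exact ⟨x, hx, rfl⟩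

/-! ### Centroid, regular polygons and symmetricity -/

/-- The centroid of a finite set of points. -/
def centroid (X : Finset ℂ) : ℂ := (∑ x ∈ X, x) / X.card

theorem sum_eq_card_mul_centroid (X : Finset ℂ) (hX : X.Nonempty) :
    ∑ x ∈ X, x = X.card * centroid X := by
  have : (X.card : ℂ) ≠ 0 := by exact_mod_cast hX.card_pos.ne'
  rw [centroid]; field_simp

theorem isRegularGon_iff {m : ℕ} (hm : 0 < m) {c : ℂ} {S : Set ℂ} :
    IsRegularGon m c S ↔ ∃ z : ℂ, (z ≠ 0 ∨ m = 1) ∧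
      S = (fun w => c + z * w) '' (nthRootsFinset m (1 : ℂ) : Set ℂ) := by
  have h : (nthRootsFinset m (1 : ℂ) : Set ℂ) = Set.range fun k : Fin m =>
      Complex.exp (2 * Real.pi * Complex.I * ((k : ℕ) : ℂ) / (m : ℂ)) := by
    have hm0 : (m : ℂ) ≠ 0 := by exact_mod_cast hm.ne'
    ext w
    rw [Finset.mem_coe, mem_roots hm]
    constructor
    · intro hw
      have := NeZero.of_pos hm
      obtain ⟨i, hi, h⟩ := (Complex.isPrimitiveRoot_exp m hm.ne').eq_pow_of_pow_eq_one hw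
      refine ⟨⟨i, hi⟩, ?_⟩
      rw [← h, ← Complex.exp_nat_mul]
      simp only [mul_comm, mul_div_assoc]
    · rintro ⟨k, rfl⟩
      rw [← Complex.exp_nat_mul, Complex.exp_eq_one_iff]
      refine ⟨(k : ℕ), ?_⟩
      push_cast
      field_simp
  unfold IsRegularGon
  rw [h]
  simp only [← Set.range_comp, Function.comp_def]

theorem card_of_isRegularGon {m : ℕ} (hm : 0 < m) {c : ℂ} {S : Finset ℂ}
    (hS : IsRegularGon m c (S : Set ℂ)) : S.card = m := by
  obtain ⟨z, hz, h⟩ := (isRegularGon_iff hm).1 hS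
  rw [← Finset.coe_image, Finset.coe_inj] at h
  rcases hz with hz | rfl
  · rw [h, Finset.card_image_of_injective _ fun a b hab =>
      mul_left_cancel₀ hz (add_left_cancel hab), card_roots hm]
  · rw [h, Finset.card_image_of_injOn, card_roots one_pos]
    intro v hv w hw _
    rw [Finset.mem_coe, mem_roots one_pos, pow_one] at hv hw
    rw [hv, hw]

theorem card_of_finpartition {m : ℕ} (hm : 0 < m) {c : ℂ} {X : Finset ℂ} (parts : Finpartition X)
    (h : ∀ S ∈ parts.parts, IsRegularGon m c (S : Set ℂ)) : parts.parts.card * m = X.card := by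
  rw [← parts.sum_card_parts, Finset.sum_const_nat]
  exact fun S hS => card_of_isRegularGon hm (h S hS)

theorem le_card_of_hasRegularPartition {m : ℕ} (hm : 0 < m) {X : Finset ℂ} (hX : X.Nonempty)
    (h : HasRegularPartition m X) : m ≤ X.card := by
  obtain ⟨c, -, parts, hp⟩ := h
  have h1 := card_of_finpartition hm parts hp
  have : 0 < parts.parts.card := by
    have := hX.card_pos
    rw [← h1] at this
    exact Nat.pos_of_mul_pos_right this
  nlinarith

theorem bddAbove_regularPartition {X : Finset ℂ} (hX : X.Nonempty) :
    BddAbove {m : ℕ | 1 ≤ m ∧ HasRegularPartition m X} :=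
  ⟨X.card, fun _ h => le_card_of_hasRegularPartition h.1 hX h.2⟩

theorem le_symmetricity {X : Finset ℂ} (hX : X.Nonempty) {m : ℕ} (hm : 1 ≤ m)
    (h : HasRegularPartition m X) : m ≤ symmetricity X :=
  le_csSup (bddAbove_regularPartition hX) ⟨hm, h⟩

theorem hasRegularPartition_symmetricity {X : Finset ℂ} (hX : X.Nonempty)
    (h : symmetricity X ≠ 0) : HasRegularPartition (symmetricity X) X := by
  have hne : {m : ℕ | 1 ≤ m ∧ HasRegularPartition m X}.Nonempty := by
    by_contra h0
    rw [Set.not_nonempty_iff_eq_empty] at h0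
    -- The supremum of the empty set is 0, which the hypothesis excludes.
    exact h (by rw [symmetricity, h0, Nat.sSup_def ⟨0, by simp⟩]; simp)
  exact (Nat.sSup_mem hne (bddAbove_regularPartition hX)).2

theorem sum_roots_eq_zero {d : ℕ} (hd : 2 ≤ d) : ∑ w ∈ nthRootsFinset d (1 : ℂ), w = 0 := by
  have hd0 : 0 < d := by omega
  set ζ := Complex.exp (2 * Real.pi * Complex.I / d)
  have hζ : IsPrimitiveRoot ζ d := Complex.isPrimitiveRoot_exp d hd0.ne'
  have h1 : ζ * ∑ w ∈ nthRootsFinset d (1 : ℂ), w = ∑ w ∈ nthRootsFinset d (1 : ℂ), w := by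
    rw [Finset.mul_sum]
    refine Finset.sum_bij' (fun w _ => ζ * w) (fun w _ => ζ⁻¹ * w) ?_ ?_ ?_ ?_ ?_
    · intro w hw
      rw [mem_roots hd0] at hw ⊢
      rw [mul_pow, hw, hζ.pow_eq_one, one_mul]
    · intro w hw
      rw [mem_roots hd0] at hw ⊢
      rw [mul_pow, hw, inv_pow, hζ.pow_eq_one, inv_one, one_mul]
    · intro w _
      simp [hζ.ne_zero hd0.ne']
    · intro w _
      simp [hζ.ne_zero hd0.ne']
    · intro w _
      rfl
  have h2 : (ζ - 1) * ∑ w ∈ nthRootsFinset d (1 : ℂ), w = 0 := by rw [sub_mul, h1]; ring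
  exact (mul_eq_zero.1 h2).resolve_left (sub_ne_zero.2 (hζ.ne_one hd))

theorem conj_eq_inv_of_root {d : ℕ} (hd : 0 < d) {w : ℂ} (hw : w ^ d = 1) :
    (starRingEnd ℂ) w = w⁻¹ := by
  have := norm_of_pow_eq_one hd hw
  rw [Complex.inv_def, Complex.normSq_eq_norm_sq, this]
  simp

/-- A set that is invariant under the rotations of order `d` about a point which it does not
contain can be partitioned into regular `d`-gons. -/
theorem hasRegularPartition_of_invariant {X : Finset ℂ} (hX : X.Nonempty) {d : ℕ} (hd : 2 ≤ d)
    {c : ℂ} (hc : c ∉ X) (h : ∀ w : ℂ, w ^ d = 1 → ∀ x ∈ X, c + w * (x - c) ∈ X) :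
    HasRegularPartition d X := by
  have hd0 : 0 < d := by omega
  refine ⟨c, ?_, ?_⟩
  · obtain ⟨x, hx, hmax⟩ := X.exists_max_image (fun x => dist x c) hX
    refine ⟨dist x c, fun y hy => hmax y hy, ?_⟩
    intro c' r' hr
    -- A disc about `c'` that contains the orbit of `x` has radius at least |x - c|: rotate the
    -- vectors from `c'` to the orbit points back and average. The terms with c - c' cancel because
    -- the roots of unity sum to zero.
    have h1 : ∑ w ∈ nthRootsFinset d (1 : ℂ), (starRingEnd ℂ) w * (c + w * (x - c) - c') =
        d * (x - c) := by
      have h2 : ∀ w ∈ nthRootsFinset d (1 : ℂ), (starRingEnd ℂ) w * (c + w * (x - c) - c') =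
          (starRingEnd ℂ) w * (c - c') + (x - c) := by
        intro w hw
        rw [mem_roots hd0] at hw
        have hw0 : w ≠ 0 := by
          rintro rfl
          simp [hd0.ne'] at hw
        rw [conj_eq_inv_of_root hd0 hw]
        field_simp
        ring
      rw [Finset.sum_congr rfl h2, Finset.sum_add_distrib, ← Finset.sum_mul, ← map_sum,
        sum_roots_eq_zero hd, map_zero, zero_mul, zero_add, Finset.sum_const, card_roots hd0,
        nsmul_eq_mul]
    have h3 : ‖(d : ℂ) * (x - c)‖ ≤ d * r' := by
      rw [← h1]
      refine (norm_sum_le _ _).trans ?_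
      have : ∀ w ∈ nthRootsFinset d (1 : ℂ),
          ‖(starRingEnd ℂ) w * (c + w * (x - c) - c')‖ ≤ r' := by
        intro w hw
        rw [mem_roots hd0] at hw
        rw [norm_mul, RCLike.norm_conj, norm_of_pow_eq_one hd0 hw, one_mul, ← dist_eq_norm]
        exact hr (h w hw x hx)
      refine (Finset.sum_le_sum this).trans ?_
      rw [Finset.sum_const, card_roots hd0, nsmul_eq_mul]
    rw [norm_mul, Complex.norm_natCast, ← dist_eq_norm] at h3
    exact le_of_mul_le_mul_left h3 (by exact_mod_cast hd0)
  · let Y := X.image (· - c)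
    have hY0 : (0 : ℂ) ∉ Y := by
      simp only [Y, Finset.mem_image, sub_eq_zero, not_exists, not_and]
      rintro x hx rfl
      exact hc hx
    have hY : ∀ w : ℂ, w ^ d = 1 → ∀ y ∈ Y, w * y ∈ Y := by
      intro w hw y hy
      obtain ⟨x, hx, rfl⟩ := Finset.mem_image.1 hy
      exact Finset.mem_image.2 ⟨_, h w hw x hx, by ring⟩
    let part : ℂ → Finset ℂ := fun x => X.filter fun y => (y - c) ^ d = (x - c) ^ d
    refine ⟨Finpartition.ofExistsUnique (X.image part) ?_ ?_ ?_, ?_⟩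
    · intro S hS
      obtain ⟨x, -, rfl⟩ := Finset.mem_image.1 hS
      exact Finset.filter_subset _ _
    · intro x hx
      refine ⟨part x, ⟨Finset.mem_image_of_mem _ hx, by simp [part, hx]⟩, ?_⟩
      rintro S ⟨hS, hxS⟩
      obtain ⟨y, -, rfl⟩ := Finset.mem_image.1 hS
      have := (Finset.mem_filter.1 hxS).2
      simp only [part, this]
    · intro h0
      obtain ⟨x, hx, h0⟩ := Finset.mem_image.1 h0
      have : x ∈ part x := by simp [part, hx]
      rw [h0] at this
      simp at this
    · intro S hS
      obtain ⟨x, hx, rfl⟩ := Finset.mem_image.1 hS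
      rw [isRegularGon_iff hd0]
      refine ⟨x - c, Or.inl (sub_ne_zero.2 fun h => hc (h ▸ hx)), ?_⟩
      have h1 := filter_pow_eq hd0 hY0 hY (Finset.mem_image_of_mem (· - c) hx)
      ext y
      have h2 := Finset.ext_iff.1 h1 (y - c)
      simp only [Y, Finset.mem_filter, Finset.mem_image, sub_left_inj, exists_eq_right] at h2
      rw [Finset.mem_coe, Finset.mem_filter, h2]
      simp only [Set.mem_image, Finset.mem_coe]
      constructor
      · rintro ⟨w, hw, h⟩
        exact ⟨w, hw, by linear_combination h⟩
      · rintro ⟨w, hw, h⟩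
        exact ⟨w, hw, by linear_combination h⟩

theorem exists_center_of_hasRegularPartition {X : Finset ℂ} {m : ℕ} (hm : 0 < m)
    (h : HasRegularPartition m X) :
    ∃ c : ℂ, ∀ w : ℂ, w ^ m = 1 → ∀ x ∈ X, c + w * (x - c) ∈ X := by
  obtain ⟨c, -, parts, hp⟩ := h
  refine ⟨c, fun w hw x hx => ?_⟩
  obtain ⟨S, hS, hxS⟩ := parts.exists_mem hx
  obtain ⟨z, -, hz⟩ := (isRegularGon_iff hm).1 (hp S hS)
  have h1 : x ∈ (S : Set ℂ) := hxS
  rw [hz] at h1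
  obtain ⟨v, hv, rfl⟩ := h1
  apply parts.le hS
  rw [← Finset.mem_coe, hz]
  refine ⟨w * v, ?_, by ring⟩
  rw [Finset.mem_coe, mem_roots hm] at hv ⊢
  rw [mul_pow, hw, hv, one_mul]

/-- The map permutes `X` and hence fixes the centroid, but a map z ↦ c + w (z - c) with w ≠ 1 has no
fixed point besides `c`. This identifies the center in the definition of symmetricity with the
centroid. -/
theorem eq_centroid_of_invariant {X : Finset ℂ} (hX : X.Nonempty) {c w : ℂ} (hw : w ≠ 1)
    (hw0 : w ≠ 0) (h : ∀ x ∈ X, c + w * (x - c) ∈ X) : c = centroid X := by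
  have hinj : Function.Injective fun x : ℂ => c + w * (x - c) := fun a b hab =>
    sub_left_inj.1 (mul_left_cancel₀ hw0 (add_left_cancel hab))
  have himg : X.image (fun x => c + w * (x - c)) = X := by
    apply Finset.eq_of_subset_of_card_le
    · intro y hy
      obtain ⟨x, hx, rfl⟩ := Finset.mem_image.1 hy
      exact h x hx
    · rw [Finset.card_image_of_injective _ hinj]
  have h1 : ∑ x ∈ X, (c + w * (x - c)) = ∑ x ∈ X, x := by
    conv_rhs => rw [← himg]
    rw [Finset.sum_image fun a _ b _ hab => hinj hab]
  rw [Finset.sum_add_distrib, ← Finset.mul_sum, Finset.sum_sub_distrib, Finset.sum_const,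
    nsmul_eq_mul, sum_eq_card_mul_centroid X hX] at h1
  have hc : (X.card : ℂ) ≠ 0 := by exact_mod_cast hX.card_pos.ne'
  have h2 : (X.card : ℂ) * ((1 - w) * (c - centroid X)) = 0 := by linear_combination h1
  rcases mul_eq_zero.1 h2 with h2 | h2
  · exact absurd h2 hc
  rcases mul_eq_zero.1 h2 with h2 | h2
  · exact absurd (sub_eq_zero.1 h2).symm hw
  · exact sub_eq_zero.1 h2

/-- If the centroid of `X` is not in `X`, then the order of the rotation group of `X` divides
its symmetricity. -/
theorem card_stabilizer_dvd_symmetricity {X : Finset ℂ} (hX : X.Nonempty)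
    (hg : centroid X ∉ X) :
    Nat.card (MulAction.stabilizer Circle ((X.image (· - centroid X) : Finset ℂ) : Set ℂ)) ∣
      symmetricity X := by
  set g := centroid X with hgdef
  have hY0 : (0 : ℂ) ∉ X.image (· - g) := by
    simp only [Finset.mem_image, sub_eq_zero, not_exists, not_and]
    rintro x hx rfl
    exact hg hx
  obtain ⟨hpos, hst⟩ := exists_mem_stabilizer_iff (hX.image (· - g)) hY0
  set d := Nat.card (MulAction.stabilizer Circle ((X.image (· - g) : Finset ℂ) : Set ℂ))
  by_cases hd1 : d = 1
  · rw [hd1]; exact one_dvd _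
  have hd : 2 ≤ d := by omega
  have hle : d ≤ symmetricity X := by
    refine le_symmetricity hX hpos (hasRegularPartition_of_invariant hX hd hg ?_)
    intro w hw x hx
    obtain ⟨u, hu, rfl⟩ := (hst w).1 hw
    have h1 : u • ((X.image (· - g) : Finset ℂ) : Set ℂ) = (X.image (· - g) : Finset ℂ) := hu
    have h2 : u • (x - g) ∈ u • ((X.image (· - g) : Finset ℂ) : Set ℂ) :=
      Set.smul_mem_smul_set (Finset.mem_coe.2 (Finset.mem_image_of_mem _ hx))
    rw [h1, Finset.mem_coe, Finset.mem_image] at h2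
    obtain ⟨y, hy, h2⟩ := h2
    have : g + (u : ℂ) * (x - g) = y := by
      rw [Circle.smul_def, smul_eq_mul] at h2
      linear_combination -h2
    rwa [this]
  set D := symmetricity X
  have hD0 : 0 < D := hpos.trans_le hle
  obtain ⟨c, hc⟩ := exists_center_of_hasRegularPartition hD0
    (hasRegularPartition_symmetricity hX hD0.ne')
  have hD2 : 2 ≤ D := hd.trans hle
  have hζ : IsPrimitiveRoot (Complex.exp (2 * Real.pi * Complex.I / D)) D :=
    Complex.isPrimitiveRoot_exp D hD0.ne'
  have hcg : c = g := eq_centroid_of_invariant hX (hζ.ne_one hD2) (hζ.ne_zero hD0.ne')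
    (hc _ hζ.pow_eq_one)
  subst hcg
  -- The D-gons are centered at the centroid as well, so every D-th root of unity lies in the
  -- rotation group. Hence D ≤ d, and the two numbers agree.
  have hsub : nthRootsFinset D (1 : ℂ) ⊆ nthRootsFinset d (1 : ℂ) := by
    intro w hw
    rw [mem_roots hD0] at hw
    rw [mem_roots hpos, hst]
    let u : Circle := ⟨w, by simp [Submonoid.unitSphere, norm_of_pow_eq_one hD0 hw]⟩
    refine ⟨u, ?_, rfl⟩
    have hle : ∀ v : Circle, (v : ℂ) ^ D = 1 →
        v • ((X.image (· - g) : Finset ℂ) : Set ℂ) ⊆ (X.image (· - g) : Finset ℂ) := by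
      rintro v hv _ ⟨y, hy, rfl⟩
      rw [Finset.mem_coe, Finset.mem_image] at hy
      obtain ⟨x, hx, rfl⟩ := hy
      rw [Finset.mem_coe, Finset.mem_image]
      exact ⟨_, hc v hv x hx, by simp⟩
    refine Set.Subset.antisymm (hle u hw) ?_
    have h1 := hle u⁻¹ (by
      rw [Circle.coe_inv, inv_pow]
      exact inv_eq_one.2 hw)
    intro y hy
    exact Set.mem_smul_set_iff_inv_smul_mem.2 (h1 (Set.smul_mem_smul_set hy))
  have := Finset.card_le_card hsub
  rw [card_roots hD0, card_roots hpos] at this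
  rw [le_antisymm hle this]

/-- A finite set with symmetricity `m ≥ 2` and at most `2 * m` points consists of one or two
regular `m`-gons around a common center. -/
theorem exists_orbits {X : Finset ℂ} (hX : X.Nonempty) (hm : 2 ≤ symmetricity X)
    (hc : X.card ≤ 2 * symmetricity X) :
    ∃ c : ℂ, (∃ a : ℂ, a ≠ 0 ∧ X.card = symmetricity X ∧
        ∀ x, x ∈ X ↔ ∃ w : ℂ, w ^ symmetricity X = 1 ∧ x = c + a * w) ∨
      ∃ a b : ℂ, a ≠ 0 ∧ b ≠ 0 ∧ X.card = 2 * symmetricity X ∧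
        ∀ x, x ∈ X ↔ ∃ w : ℂ, w ^ symmetricity X = 1 ∧ (x = c + a * w ∨ x = c + b * w) := by
  set m := symmetricity X
  have hm0 : 0 < m := by omega
  obtain ⟨c, -, parts, hp⟩ := hasRegularPartition_symmetricity hX hm0.ne'
  have hcard := card_of_finpartition hm0 parts hp
  have hgon : ∀ S ∈ parts.parts, ∃ z : ℂ, z ≠ 0 ∧
      ∀ x, x ∈ S ↔ ∃ w : ℂ, w ^ m = 1 ∧ x = c + z * w := by
    intro S hS
    obtain ⟨z, hz, h⟩ := (isRegularGon_iff hm0).1 (hp S hS)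
    refine ⟨z, hz.resolve_right (by omega), fun x => ?_⟩
    rw [← Finset.mem_coe, h]
    simp only [Set.mem_image, Finset.mem_coe, mem_roots hm0, eq_comm]
  have hk : parts.parts.card ≤ 2 := by
    by_contra h
    have : 3 * m ≤ parts.parts.card * m := Nat.mul_le_mul_right m (by omega)
    omega
  have hk0 : parts.parts.card ≠ 0 := by
    intro h
    rw [h] at hcard
    have := hX.card_pos
    omega
  have hmem : ∀ x, x ∈ X ↔ ∃ S ∈ parts.parts, x ∈ S := fun x =>
    ⟨fun hx => parts.exists_mem hx, fun ⟨S, hS, h⟩ => parts.le hS h⟩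
  refine ⟨c, ?_⟩
  have : parts.parts.card = 1 ∨ parts.parts.card = 2 := by omega
  rcases this with h1 | h2
  · left
    obtain ⟨S, hS⟩ := Finset.card_eq_one.1 h1
    obtain ⟨a, ha, h⟩ := hgon S (by simp [hS])
    refine ⟨a, ha, by rw [← hcard, h1, one_mul], fun x => ?_⟩
    rw [hmem, hS]
    simp [h]
  · right
    obtain ⟨S, T, hST, hS⟩ := Finset.card_eq_two.1 h2
    obtain ⟨a, ha, h⟩ := hgon S (by simp [hS])
    obtain ⟨b, hb, h'⟩ := hgon T (by simp [hS])
    refine ⟨a, b, ha, hb, by rw [← hcard, h2], fun x => ?_⟩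
    rw [hmem, hS]
    simp only [Finset.mem_insert, Finset.mem_singleton, exists_eq_or_imp, exists_eq_left, h, h']
    grind

theorem two_le_symmetricity_of_card_eq_two {X : Finset ℂ} (hX : X.card = 2) :
    2 ≤ symmetricity X := by
  have hne : X.Nonempty := Finset.card_pos.1 (by omega)
  obtain ⟨a, b, hab, rfl⟩ := Finset.card_eq_two.1 hX
  have h2 : (2 : ℂ) ≠ 0 := two_ne_zero
  refine le_symmetricity hne (by norm_num)
    (hasRegularPartition_of_invariant hne le_rfl (c := (a + b) / 2) ?_ ?_)
  · simp only [Finset.mem_insert, Finset.mem_singleton, not_or]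
    refine ⟨fun h => hab ?_, fun h => hab ?_⟩
    · linear_combination -2 * h
    · linear_combination 2 * h
  · intro w hw x hx
    have hw' : w = 1 ∨ w = -1 := by simpa using hw
    simp only [Finset.mem_insert, Finset.mem_singleton] at hx ⊢
    rcases hw' with rfl | rfl <;> rcases hx with rfl | rfl
    · left; ring
    · right; ring
    · right; ring
    · left; ring

/-! ### Expansion plans -/

/-- The part of the configuration `w` that is visible from its `i`-th point, relative to it. -/
def view {ι : Type*} (w : ι → ℂ) (i : ι) : Set ℂ := {z | ‖z‖ ≤ 1 ∧ ∃ j, w i + z = w j}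

/-- A sequence of configurations, one for every level, such that every robot can compute from
what it sees its move to the next lower level. In level `0` the robots do not move. -/
structure ExpansionPlan (ι : Type*) where
  pos : ℕ → ι → ℂ
  norm_le : ∀ l i, ‖pos (l - 1) i - pos l i‖ ≤ 1
  consistent : ∀ l l' i i' (u : Circle), view (pos l) i = u • view (pos l') i' →
    pos (l - 1) i - pos l i = u * (pos (l' - 1) i' - pos l' i')

namespace ExpansionPlan

variable {ι : Type*} (E : ExpansionPlan ι)

/-- The move `t` is prescribed by the plan for a robot that sees `V`. -/
def Rule (V : Set ℂ) (t : ℂ) : Prop :=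
  ∃ l i, ∃ u : Circle, V = u • view (E.pos l) i ∧ t = u * (E.pos (l - 1) i - E.pos l i)

/-- The robots stand on a copy of the configuration of level `l`. -/
def AtLevel (l : ℕ) {n : ℕ} (p : Configuration n) : Prop :=
  ∃ (a : Circle) (b : ℂ), Set.range p = Set.range fun i => (a : ℂ) * E.pos l i + b

theorem Rule.unique {V : Set ℂ} {t t' : ℂ} (h : E.Rule V t) (h' : E.Rule V t') : t = t' := by
  obtain ⟨l, i, u, hV, rfl⟩ := h
  obtain ⟨l', i', u', hV', rfl⟩ := h'
  have h1 : view (E.pos l) i = (u⁻¹ * u') • view (E.pos l') i' := by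
    rw [mul_smul, ← hV', hV, inv_smul_smul]
  rw [E.consistent l l' i i' _ h1]
  push_cast
  have := Circle.coe_ne_zero u
  field_simp

theorem Rule.norm_le {V : Set ℂ} {t : ℂ} (h : E.Rule V t) : ‖t‖ ≤ 1 := by
  obtain ⟨l, i, u, -, rfl⟩ := h
  rw [norm_mul, Circle.norm_coe, one_mul]
  exact E.norm_le l i

end ExpansionPlan

/-! ### The protocol and its run from a near-gathering -/

/-- The move of a robot that sees a near-gathering `V` of `n` robots. -/
def gatheringMove (n : ℕ) (F : Set ℂ → ℂ → ℂ) (V : Finset ℂ) : ℂ := by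
  classical
  exact
  if centroid V ∈ V then
    -- The robot on the centroid sees it at its own origin and steps aside along its first axis; the
    -- direction is irrelevant, as only this robot moves. The bound on ε keeps it the closest robot
    -- to the new centroid.
    if h : centroid V = 0 ∧ ∃ ε : ℝ, 0 < ε ∧ ε ≤ 1 ∧ ∀ z ∈ V, z ≠ 0 → n * ε ≤ ‖z‖ then
      (h.2.choose : ℂ)
    else 0
  -- The robot is at the origin, so `-centroid V` is its own position relative to the centroid.
  else centroid V + F (V.image (· - centroid V) : Finset ℂ) (-centroid V)

/-- The move before it is checked that it is not too long. -/
def rawMove {ι : Type*} (E : ExpansionPlan ι) (n : ℕ) (F : Set ℂ → ℂ → ℂ) (V : Set ℂ) : ℂ := by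
  classical
  exact
  if h : ∃ t, E.Rule V t then h.choose
  else if h : V.Finite then gatheringMove n F h.toFinset else 0

/-- The robots follow the plan `E`; a near-gathering is first transformed according to `F`. -/
def planProtocol {ι : Type*} (E : ExpansionPlan ι) (n : ℕ) (F : Set ℂ → ℂ → ℂ) : Protocol where
  -- The cutoff only serves the bound required of a protocol; it never acts in the runs considered
  -- below.
  target V := if ‖rawMove E n F V‖ ≤ 1 then rawMove E n F V else 0
  norm_target_le V := by split_ifs with h <;> simp [h]

section

variable {ι : Type*} {E : ExpansionPlan ι} {n : ℕ} {F : Set ℂ → ℂ → ℂ}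

theorem target_of_rule {V : Set ℂ} {t : ℂ} (h : E.Rule V t) :
    (planProtocol E n F).target V = t := by
  have h1 : rawMove E n F V = t := by
    have hex : ∃ t, E.Rule V t := ⟨t, h⟩
    rw [rawMove, dif_pos hex]
    exact hex.choose_spec.unique E h
  simp only [planProtocol]
  rw [if_pos (by rw [h1]; exact h.norm_le E), h1]

theorem snapshot_of_atLevel {l : ℕ} {p : Configuration n} {a : Circle} {b : ℂ}
    (h : Set.range p = Set.range fun i => (a : ℂ) * E.pos l i + b) (u : Circle) {j : Fin n} {i : ι}
    (hj : p j = a * E.pos l i + b) : snapshot p u j = (u⁻¹ * a) • view (E.pos l) i := by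
  have hu := Circle.coe_ne_zero u
  have ha := Circle.coe_ne_zero a
  ext z
  refine Iff.trans ?_ Set.mem_smul_set_iff_inv_smul_mem.symm
  have hn : ‖(u⁻¹ * a)⁻¹ • z‖ = ‖z‖ := by
    rw [Circle.smul_def, norm_smul, Circle.norm_coe, one_mul]
  have hz : ((a : ℂ) * ((u⁻¹ * a)⁻¹ • z)) = u * z := by
    rw [Circle.smul_def, smul_eq_mul]
    push_cast
    field_simp
  simp only [snapshot, view, Set.mem_ofPred_eq, hn]
  constructor
  · rintro ⟨j', hd, hj'⟩
    have h1 : p j' ∈ Set.range p := ⟨j', rfl⟩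
    rw [h] at h1
    obtain ⟨i', hi'⟩ := h1
    simp only at hi'
    refine ⟨?_, i', mul_left_cancel₀ ha ?_⟩
    · rwa [dist_eq_norm, ← hj', add_sub_cancel_left, norm_mul, Circle.norm_coe, one_mul] at hd
    · rw [mul_add, hz]
      linear_combination hj' - hj - hi'
  · rintro ⟨hd, i', hi'⟩
    have h1 : (a : ℂ) * E.pos l i' + b ∈ Set.range p := by
      rw [h]
      exact ⟨i', rfl⟩
    obtain ⟨j', hj'⟩ := h1
    have h2 : p j + u * z = p j' := by
      rw [hj', ← hi', hj, mul_add, hz]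
      ring
    refine ⟨j', ?_, h2⟩
    rwa [dist_eq_norm, ← h2, add_sub_cancel_left, norm_mul, Circle.norm_coe, one_mul]

theorem step_of_atLevel {l : ℕ} {p : Configuration n} {a : Circle} {b : ℂ}
    (h : Set.range p = Set.range fun i => (a : ℂ) * E.pos l i + b) (u : Fin n → Circle) {j : Fin n}
    {i : ι} (hj : p j = a * E.pos l i + b) :
    (planProtocol E n F).step u p j = a * E.pos (l - 1) i + b := by
  have hu := Circle.coe_ne_zero (u j)
  rw [Protocol.step, target_of_rule ⟨l, i, _, snapshot_of_atLevel h (u j) hj, rfl⟩, hj]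
  push_cast
  field_simp
  ring

theorem atLevel_step {l : ℕ} {p : Configuration n} (h : E.AtLevel l p) (u : Fin n → Circle) :
    E.AtLevel (l - 1) ((planProtocol E n F).step u p) := by
  obtain ⟨a, b, h⟩ := h
  refine ⟨a, b, ?_⟩
  ext z
  constructor
  · rintro ⟨j, rfl⟩
    have h1 : p j ∈ Set.range p := ⟨j, rfl⟩
    rw [h] at h1
    obtain ⟨i, hi⟩ := h1
    exact ⟨i, (step_of_atLevel h u hi.symm).symm⟩
  · rintro ⟨i, rfl⟩
    have h1 : (a : ℂ) * E.pos l i + b ∈ Set.range p := by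
      rw [h]
      exact ⟨i, rfl⟩
    obtain ⟨j, hj⟩ := h1
    exact ⟨j, step_of_atLevel h u hj⟩

theorem step_of_atLevel_zero {p : Configuration n} (h : E.AtLevel 0 p) (u : Fin n → Circle) :
    (planProtocol E n F).step u p = p := by
  obtain ⟨a, b, h⟩ := h
  funext j
  have h1 : p j ∈ Set.range p := ⟨j, rfl⟩
  rw [h] at h1
  obtain ⟨i, hi⟩ := h1
  rw [step_of_atLevel h u hi.symm]
  exact hi

/-- Once the robots stand on a configuration of the plan, they reach level `0` and stop. -/
theorem exists_halt_of_atLevel {u : ℕ → Fin n → Circle} {p : Configuration n} {l t : ℕ}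
    (h : E.AtLevel l ((planProtocol E n F).run u p t)) :
    ∃ T, E.AtLevel 0 ((planProtocol E n F).run u p T) ∧
      ∀ t, T ≤ t → (planProtocol E n F).run u p t = (planProtocol E n F).run u p T := by
  induction l generalizing t with
  | zero =>
    refine ⟨t, h, fun s hs => ?_⟩
    induction s, hs using Nat.le_induction with
    | base => rfl
    | succ s _ ih =>
      rw [Protocol.run, ih]
      exact step_of_atLevel_zero h _
  | succ l ih => exact ih (t := t + 1) (atLevel_step h (u t))

theorem centroid_image {X : Finset ℂ} (hX : X.Nonempty) {a : ℂ} (ha : a ≠ 0) (b : ℂ) :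
    centroid (X.image fun x => a * (x - b)) = a * (centroid X - b) := by
  have hinj : Function.Injective fun x : ℂ => a * (x - b) := fun x y h =>
    sub_left_inj.1 (mul_left_cancel₀ ha h)
  have hc : (X.card : ℂ) ≠ 0 := by exact_mod_cast hX.card_pos.ne'
  rw [centroid, Finset.card_image_of_injective _ hinj, Finset.sum_image fun x _ y _ h => hinj h,
    ← Finset.mul_sum, Finset.sum_sub_distrib, sum_eq_card_mul_centroid X hX, Finset.sum_const,
    nsmul_eq_mul]
  field_simp

theorem snapshot_of_nearGathering {p : Configuration n} (hp : IsNearGathering p) (u : Circle)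
    (i : Fin n) : snapshot p u i =
      (((Finset.univ.image p).image fun x => ((u⁻¹ : Circle) : ℂ) * (x - p i) : Finset ℂ) :
        Set ℂ) := by
  have hu := Circle.coe_ne_zero u
  ext z
  simp only [snapshot, Set.mem_ofPred_eq, Finset.coe_image, Set.mem_image, Finset.coe_univ,
    Set.image_univ, Set.mem_range, exists_exists_eq_and, Circle.coe_inv]
  constructor
  · rintro ⟨j, -, h⟩
    refine ⟨j, ?_⟩
    rw [← h]
    field_simp
    ring
  · rintro ⟨j, rfl⟩
    refine ⟨j, hp.2 j i, ?_⟩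
    field_simp
    ring

theorem card_univ_image {p : Configuration n} (hp : Function.Injective p) :
    (Finset.univ.image p).card = n := by
  rw [Finset.card_image_of_injective _ hp, Finset.card_univ, Fintype.card_fin]

/-- In a near-gathering a robot sees all others, so a view that matches the plan places all `n`
robots inside a copy of a level, which has at most `n` points and is therefore filled. Thus the two
branches of the protocol cannot be mixed: if one robot follows the plan, all stand on a level. -/
theorem atLevel_of_rule [Fintype ι] (hι : Fintype.card ι = n) {p : Configuration n}
    (hp : IsNearGathering p) {u : Circle} {j : Fin n} {t : ℂ} (h : E.Rule (snapshot p u j) t) :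
    ∃ l, E.AtLevel l p := by
  obtain ⟨l, i, v, hV, -⟩ := h
  refine ⟨l, u * v, p j - u * v * E.pos l i, ?_⟩
  have hsub : Finset.univ.image p ⊆
      Finset.univ.image fun i' => ((u * v : Circle) : ℂ) * E.pos l i' +
        (p j - u * v * E.pos l i) := by
    intro x hx
    obtain ⟨j', -, rfl⟩ := Finset.mem_image.1 hx
    have h1 : ((u⁻¹ : Circle) : ℂ) * (p j' - p j) ∈ snapshot p u j := by
      rw [snapshot_of_nearGathering hp]
      exact Finset.mem_coe.2 (Finset.mem_image_of_mem _ (Finset.mem_image_of_mem _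
        (Finset.mem_univ _)))
    rw [hV] at h1
    obtain ⟨y, ⟨-, i', hi'⟩, hy⟩ := h1
    refine Finset.mem_image.2 ⟨i', Finset.mem_univ _, ?_⟩
    have hu := Circle.coe_ne_zero u
    simp only [smul_eq_mul, Circle.coe_inv] at hy
    have h2 : p j' - p j = u * v * y := by
      rw [mul_assoc, hy]
      field_simp
    rw [← hi']
    push_cast
    linear_combination -h2
  have heq := Finset.eq_of_subset_of_card_le hsub (by
    rw [card_univ_image hp.1, ← hι]
    exact Finset.card_image_le)
  have := congrArg (fun s : Finset ℂ => (s : Set ℂ)) heq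
  simpa using this

theorem target_of_nearGathering [Fintype ι] (hι : Fintype.card ι = n) {p : Configuration n}
    (hp : IsNearGathering p) (hl : ∀ l, ¬ E.AtLevel l p) (u : Circle) (j : Fin n)
    (hle : ‖gatheringMove n F
      ((Finset.univ.image p).image fun x => ((u⁻¹ : Circle) : ℂ) * (x - p j))‖ ≤ 1) :
    (planProtocol E n F).target (snapshot p u j) = gatheringMove n F
      ((Finset.univ.image p).image fun x => ((u⁻¹ : Circle) : ℂ) * (x - p j)) := by
  have hno : ¬ ∃ t, E.Rule (snapshot p u j) t := by
    rintro ⟨t, ht⟩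
    obtain ⟨l, h⟩ := atLevel_of_rule hι hp ht
    exact hl l h
  have hfin : (snapshot p u j).Finite := by
    rw [snapshot_of_nearGathering hp]
    exact Finset.finite_toSet _
  have h1 : rawMove E n F (snapshot p u j) = gatheringMove n F
      ((Finset.univ.image p).image fun x => ((u⁻¹ : Circle) : ℂ) * (x - p j)) := by
    rw [rawMove, dif_neg hno, dif_pos hfin]
    congr 1
    rw [← Finset.coe_inj, Set.Finite.coe_toFinset, snapshot_of_nearGathering hp]
  simp only [planProtocol]
  rw [h1, if_pos hle]

/-- The robot itself contributes nothing to the average of the displacements, each of length at most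
1. The slack of 1/n pays for a target that is off the centroid by up to 1/n. -/
theorem norm_centroid_sub_le {p : Configuration n} (hp : IsNearGathering p) (j : Fin n) :
    n * ‖centroid (Finset.univ.image p) - p j‖ ≤ n - 1 := by
  have hn : 0 < n := j.pos
  have hne : (Finset.univ.image p).Nonempty := ⟨p j, by simp⟩
  have h1 : (n : ℂ) * (centroid (Finset.univ.image p) - p j) = ∑ i, (p i - p j) := by
    have h0 := sum_eq_card_mul_centroid _ hne
    rw [Finset.sum_image fun x _ y _ h => hp.1 h, card_univ_image hp.1] at h0
    rw [mul_sub, ← h0, Finset.sum_sub_distrib]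
    simp
  have h2 : (n : ℝ) * ‖centroid (Finset.univ.image p) - p j‖ = ‖∑ i, (p i - p j)‖ := by
    rw [← h1, norm_mul, Complex.norm_natCast]
  rw [h2, ← Finset.sum_erase (a := j) _ (sub_self (p j))]
  have h3 : ∑ i ∈ Finset.univ.erase j, ‖p i - p j‖ ≤ ∑ i ∈ Finset.univ.erase j, (1 : ℝ) :=
    Finset.sum_le_sum fun i _ => by
      rw [← dist_eq_norm]
      exact hp.2 i j
  refine (norm_sum_le _ _).trans (h3.trans_eq ?_)
  rw [Finset.sum_const, Finset.card_erase_of_mem (Finset.mem_univ _), Finset.card_univ,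
    Fintype.card_fin, nsmul_eq_mul, mul_one, Nat.cast_pred hn]

/-- A near-gathering whose centroid is not occupied is transformed into a small copy of a
configuration of the plan. -/
theorem atLevel_step_of_nearGathering [Fintype ι] (hι : Fintype.card ι = n) {N m : ℕ}
    (hN : ∀ i, n * ‖E.pos N i‖ ≤ 1)
    (hF : ∀ X : Finset ℂ, X.card = n → (0 : ℂ) ∉ X →
      Nat.card (MulAction.stabilizer Circle (X : Set ℂ)) ∣ m →
      (∀ (u : Circle) (x : ℂ), F (u • (X : Set ℂ)) (u * x) = u * F X x) ∧
      ∃ v : Circle, F X '' X = v • Set.range (E.pos N))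
    {p : Configuration n} (hp : IsNearGathering p) (hl : ∀ l, ¬ E.AtLevel l p)
    (hc : centroid (Finset.univ.image p) ∉ Finset.univ.image p)
    (hd : Nat.card (MulAction.stabilizer Circle (((Finset.univ.image p).image
      (· - centroid (Finset.univ.image p)) : Finset ℂ) : Set ℂ)) ∣ m) (u : Fin n → Circle) :
    E.AtLevel N ((planProtocol E n F).step u p) := by
  set X := Finset.univ.image p with hX
  set g := centroid X with hg
  set Y := X.image (· - g) with hY
  have hYn : Y.card = n := by
    rw [hY, Finset.card_image_of_injective _ (sub_left_injective), hX, card_univ_image hp.1]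
  have hY0 : (0 : ℂ) ∉ Y := by
    simp only [hY, Finset.mem_image, sub_eq_zero, not_exists, not_and]
    rintro x hx rfl
    exact hc hx
  obtain ⟨hF1, v, hF2⟩ := hF Y hYn hY0 hd
  have hmemX : ∀ j, p j ∈ X := fun j => Finset.mem_image_of_mem _ (Finset.mem_univ _)
  have hmemY : ∀ j, p j - g ∈ Y := fun j => Finset.mem_image_of_mem _ (hmemX j)
  have hFn : ∀ j, (n : ℝ) * ‖F Y (p j - g)‖ ≤ 1 := by
    intro j
    have h1 : F Y (p j - g) ∈ F Y '' Y := ⟨_, hmemY j, rfl⟩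
    rw [hF2] at h1
    obtain ⟨_, ⟨i, rfl⟩, h1⟩ := h1
    rw [← h1]
    simp only [smul_eq_mul, norm_mul, Circle.norm_coe, one_mul]
    exact hN i
  have hmove : ∀ j, gatheringMove n F (X.image fun x => (((u j)⁻¹ : Circle) : ℂ) * (x - p j)) =
      ((u j)⁻¹ : Circle) * (g - p j + F Y (p j - g)) := by
    intro j
    have hne : X.Nonempty := ⟨p j, hmemX j⟩
    have hu := Circle.coe_ne_zero (u j)⁻¹
    have hinj : Function.Injective fun x : ℂ => (((u j)⁻¹ : Circle) : ℂ) * (x - p j) :=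
      fun x y h => sub_left_inj.1 (mul_left_cancel₀ hu h)
    have hcent := centroid_image hne hu (p j)
    rw [gatheringMove, if_neg, hcent]
    · have himg : (((X.image fun x => (((u j)⁻¹ : Circle) : ℂ) * (x - p j)).image
          (· - (((u j)⁻¹ : Circle) : ℂ) * (g - p j)) : Finset ℂ) : Set ℂ) = (u j)⁻¹ • (Y : Set ℂ) := by
        ext z
        constructor
        · intro hz
          obtain ⟨y, hy, rfl⟩ := Finset.mem_image.1 (Finset.mem_coe.1 hz)
          obtain ⟨x, hx, rfl⟩ := Finset.mem_image.1 hy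
          refine ⟨x - g, Finset.mem_coe.2 (Finset.mem_image_of_mem _ hx), ?_⟩
          simp only [smul_eq_mul]
          ring
        · rintro ⟨y, hy, rfl⟩
          obtain ⟨x, hx, rfl⟩ := Finset.mem_image.1 (Finset.mem_coe.1 hy)
          refine Finset.mem_coe.2 (Finset.mem_image.2 ⟨_, Finset.mem_image_of_mem _ hx, ?_⟩)
          simp only [smul_eq_mul]
          ring
      rw [himg, show -((((u j)⁻¹ : Circle) : ℂ) * (g - p j)) =
        (((u j)⁻¹ : Circle) : ℂ) * (p j - g) by ring, hF1]
      ring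
    · rw [hcent]
      intro h
      obtain ⟨x, hx, h⟩ := Finset.mem_image.1 h
      exact hc ((show x = g from hinj h) ▸ hx)
  have hn : ∀ j : Fin n, (0 : ℝ) < n := fun j => by exact_mod_cast j.pos
  have hle : ∀ j, ‖gatheringMove n F
      (X.image fun x => (((u j)⁻¹ : Circle) : ℂ) * (x - p j))‖ ≤ 1 := by
    intro j
    rw [hmove, norm_mul, Circle.norm_coe, one_mul]
    refine (norm_add_le _ _).trans (le_of_mul_le_mul_left ?_ (hn j))
    have := norm_centroid_sub_le hp j
    have := hFn j
    rw [mul_add]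
    linarith
  have hstep : ∀ j, (planProtocol E n F).step u p j = g + F Y (p j - g) := by
    intro j
    have hu := Circle.coe_ne_zero (u j)
    rw [Protocol.step, target_of_nearGathering hι hp hl (u j) j (hle j), hmove, Circle.coe_inv]
    field_simp
    ring
  refine ⟨v, g, ?_⟩
  ext z
  have h1 : z - g ∈ F Y '' Y ↔ z - g ∈ v • Set.range (E.pos N) := by rw [hF2]
  simp only [Set.mem_smul_set, Set.mem_image, Set.mem_range, exists_exists_eq_and,
    Circle.smul_def, smul_eq_mul] at h1
  constructor
  · rintro ⟨j, rfl⟩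
    obtain ⟨i, hi⟩ := h1.1 ⟨_, hmemY j, by rw [hstep]; ring⟩
    exact ⟨i, by simp only [hi]; ring⟩
  · rintro ⟨i, rfl⟩
    obtain ⟨y, hy, h⟩ := h1.2 ⟨i, by ring⟩
    obtain ⟨x, hx, rfl⟩ := Finset.mem_image.1 hy
    obtain ⟨j, -, rfl⟩ := Finset.mem_image.1 hx
    exact ⟨j, by rw [hstep, h]; ring⟩

/-- If the centroid of a near-gathering is occupied, then the robot there moves away, and the
resulting near-gathering has no rotational symmetry. -/
theorem nearGathering_step_of_centroid_mem [Fintype ι] (hι : Fintype.card ι = n) (hn : 2 ≤ n)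
    {p : Configuration n} (hp : IsNearGathering p) (hl : ∀ l, ¬ E.AtLevel l p)
    (hc : centroid (Finset.univ.image p) ∈ Finset.univ.image p) (u : Fin n → Circle)
    {q : Configuration n}
    (hq : q = (planProtocol E n F).step u p) :
    IsNearGathering q ∧ centroid (Finset.univ.image q) ∉ Finset.univ.image q ∧
    Nat.card (MulAction.stabilizer Circle (((Finset.univ.image q).image
      (· - centroid (Finset.univ.image q)) : Finset ℂ) : Set ℂ)) = 1 := by
  obtain ⟨k, -, hk⟩ := Finset.mem_image.1 hc
  set X := Finset.univ.image p with hX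
  have hmemX : ∀ j, p j ∈ X := fun j => Finset.mem_image_of_mem _ (Finset.mem_univ _)
  have hne : X.Nonempty := ⟨p k, hmemX k⟩
  have hn0 : (0 : ℝ) < n := by exact_mod_cast (by omega : 0 < n)
  have hn2 : (2 : ℝ) ≤ n := by exact_mod_cast hn
  have hcent : ∀ j, centroid (X.image fun x => (((u j)⁻¹ : Circle) : ℂ) * (x - p j)) =
      (((u j)⁻¹ : Circle) : ℂ) * (p k - p j) := by
    intro j
    rw [centroid_image hne (Circle.coe_ne_zero _), hk]
  have hmem : ∀ j, centroid (X.image fun x => (((u j)⁻¹ : Circle) : ℂ) * (x - p j)) ∈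
      X.image fun x => (((u j)⁻¹ : Circle) : ℂ) * (x - p j) := by
    intro j
    rw [hcent]
    exact Finset.mem_image_of_mem (fun x => (((u j)⁻¹ : Circle) : ℂ) * (x - p j)) (hmemX k)
  have hother : ∀ j, j ≠ k → q j = p j := by
    intro j hj
    have h1 : gatheringMove n F (X.image fun x => (((u j)⁻¹ : Circle) : ℂ) * (x - p j)) = 0 := by
      rw [gatheringMove, if_pos (hmem j), dif_neg]
      rintro ⟨h, -⟩
      rw [hcent, mul_eq_zero, sub_eq_zero] at h
      exact hj (hp.1 (h.resolve_left (Circle.coe_ne_zero _))).symm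
    rw [hq, Protocol.step, target_of_nearGathering hι hp hl (u j) j (by rw [h1]; simp), h1]
    simp
  obtain ⟨e, he0, he1, hek, hej⟩ : ∃ e : ℂ, 0 < ‖e‖ ∧ n * ‖e‖ ≤ 1 ∧ q k = p k + e ∧
      ∀ j, j ≠ k → n * ‖e‖ ≤ ‖p j - p k‖ := by
    have hex : ∃ ε : ℝ, 0 < ε ∧ ε ≤ 1 ∧
        ∀ z ∈ X.image fun x => (((u k)⁻¹ : Circle) : ℂ) * (x - p k), z ≠ 0 → n * ε ≤ ‖z‖ := by
      have hne' : (Finset.univ.erase k : Finset (Fin n)).Nonempty := by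
        rw [← Finset.card_pos, Finset.card_erase_of_mem (Finset.mem_univ _), Finset.card_univ,
          Fintype.card_fin]
        omega
      obtain ⟨j₀, hj₀, hmin⟩ := Finset.exists_min_image _ (fun j => ‖p j - p k‖) hne'
      have hpos : 0 < ‖p j₀ - p k‖ :=
        norm_pos_iff.2 (sub_ne_zero.2 fun h => Finset.ne_of_mem_erase hj₀ (hp.1 h))
      refine ⟨‖p j₀ - p k‖ / n, div_pos hpos hn0, ?_, ?_⟩
      · rw [div_le_one hn0, ← dist_eq_norm]
        exact (hp.2 j₀ k).trans (by linarith)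
      · intro z hz hz0
        obtain ⟨x, hx, rfl⟩ := Finset.mem_image.1 hz
        obtain ⟨j, -, rfl⟩ := Finset.mem_image.1 hx
        have hjk : j ≠ k := by
          rintro rfl
          simp at hz0
        rw [mul_div_cancel₀ _ hn0.ne', norm_mul, Circle.norm_coe, one_mul]
        exact hmin j (Finset.mem_erase.2 ⟨hjk, Finset.mem_univ _⟩)
    have hpos : centroid (X.image fun x => (((u k)⁻¹ : Circle) : ℂ) * (x - p k)) = 0 ∧
        ∃ ε : ℝ, 0 < ε ∧ ε ≤ 1 ∧
        ∀ z ∈ X.image fun x => (((u k)⁻¹ : Circle) : ℂ) * (x - p k), z ≠ 0 → n * ε ≤ ‖z‖ :=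
      ⟨by rw [hcent]; simp, hex⟩
    have h1 : gatheringMove n F (X.image fun x => (((u k)⁻¹ : Circle) : ℂ) * (x - p k)) =
        (hpos.2.choose : ℂ) := by
      rw [gatheringMove, if_pos (hmem k), dif_pos hpos]
    obtain ⟨h2, h3, h4⟩ := hpos.2.choose_spec
    set ε := hpos.2.choose
    have hej : ∀ j, j ≠ k → n * ε ≤ ‖p j - p k‖ := by
      intro j hj
      have h5 := h4 ((((u k)⁻¹ : Circle) : ℂ) * (p j - p k))
        (Finset.mem_image_of_mem (fun x => (((u k)⁻¹ : Circle) : ℂ) * (x - p k)) (hmemX j))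
        (mul_ne_zero (Circle.coe_ne_zero _) (sub_ne_zero.2 fun h => hj (hp.1 h)))
      rwa [norm_mul, Circle.norm_coe, one_mul] at h5
    have hnorm : ‖(u k : ℂ) * (ε : ℂ)‖ = ε := by
      rw [norm_mul, Circle.norm_coe, one_mul, Complex.norm_real, Real.norm_of_nonneg h2.le]
    refine ⟨u k * (ε : ℂ), by rwa [hnorm], ?_, ?_, by rwa [hnorm]⟩
    · have : Nontrivial (Fin n) := Fin.nontrivial_iff_two_le.2 hn
      obtain ⟨j, hj⟩ := exists_ne k
      rw [hnorm]
      refine (hej j hj).trans ?_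
      rw [← dist_eq_norm]
      exact hp.2 j k
    · have h5 : ‖gatheringMove n F
          (X.image fun x => (((u k)⁻¹ : Circle) : ℂ) * (x - p k))‖ ≤ 1 := by
        rw [h1, Complex.norm_real, Real.norm_of_nonneg h2.le]
        exact h3
      rw [hq, Protocol.step, target_of_nearGathering hι hp hl (u k) k h5, h1]
  -- From here on only the displacement `e` of robot `k` matters. Everybody is within 1 - 1/n of the
  -- old centroid and |e| ≤ 1/n, so the diameter stays at most 1.
  clear hcent hmem hq
  have hdist : ∀ j, n * dist (p j) (p k) ≤ n - 1 := by
    intro j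
    rw [dist_comm, dist_eq_norm, hk]
    exact norm_centroid_sub_le hp j
  have hlt : ‖e‖ < n * ‖e‖ := by nlinarith
  have hqk : ∀ j, j ≠ k → dist (q j) (q k) ≤ 1 ∧ q j ≠ q k := by
    intro j hj
    rw [hother j hj, hek]
    constructor
    · rw [dist_eq_norm, ← sub_sub]
      refine (norm_sub_le _ _).trans (le_of_mul_le_mul_left ?_ hn0)
      have := hdist j
      rw [dist_eq_norm] at this
      rw [mul_add]
      linarith
    · intro h
      have h1 := hej j hj
      rw [h, add_sub_cancel_left] at h1
      linarith
  have hqinj : Function.Injective q := by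
    intro i j hij
    by_cases hi : i = k <;> by_cases hj : j = k
    · rw [hi, hj]
    · subst hi
      exact absurd hij.symm (hqk j hj).2
    · subst hj
      exact absurd hij (hqk i hi).2
    · rw [hother i hi, hother j hj] at hij
      exact hp.1 hij
  have hqng : IsNearGathering q := by
    refine ⟨hqinj, fun i j => ?_⟩
    by_cases hi : i = k <;> by_cases hj : j = k
    · rw [hi, hj, dist_self]
      exact zero_le_one
    · subst hi
      rw [dist_comm]
      exact (hqk j hj).1
    · subst hj
      exact (hqk i hi).1
    · rw [hother i hi, hother j hj]
      exact hp.2 i j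
  have hnC : (n : ℂ) ≠ 0 := by exact_mod_cast hn0.ne'
  have hqc : centroid (Finset.univ.image q) = p k + e / n := by
    have h1 : ∑ j, q j = ∑ j, p j + e := by
      rw [← Finset.add_sum_erase _ _ (Finset.mem_univ k),
        ← Finset.add_sum_erase _ p (Finset.mem_univ k), hek,
        Finset.sum_congr rfl fun j hj => hother j (Finset.ne_of_mem_erase hj)]
      ring
    have h2 := sum_eq_card_mul_centroid X hne
    rw [← hk, hX, card_univ_image hp.1, Finset.sum_image fun x _ y _ h => hp.1 h] at h2
    rw [centroid, card_univ_image hqinj, Finset.sum_image fun x _ y _ h => hqinj h, h1, h2]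
    field_simp
  have hen : ‖e / (n : ℂ)‖ = ‖e‖ / n := by rw [norm_div, Complex.norm_natCast]
  -- Robot `k` is now strictly closest to the new centroid without being on it. A rotation that
  -- preserves the configuration must fix it and is therefore trivial.
  have hfar : ∀ j, j ≠ k → ‖e‖ - ‖e‖ / n < ‖q j - (p k + e / n)‖ := by
    intro j hj
    rw [hother j hj, ← sub_sub]
    have h1 := norm_sub_norm_le (p j - p k) (e / n)
    rw [hen] at h1
    have := hej j hj
    linarith
  have hsmall : ‖e‖ / n < ‖e‖ := div_lt_self he0 (by linarith)
  have hqk0 : q k - (p k + e / n) = e * (1 - 1 / n) := by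
    rw [hek]
    ring
  have h1n : (1 - 1 / n : ℂ) = ((1 - 1 / n : ℝ) : ℂ) := by push_cast; rfl
  have h1n0 : 0 < (1 - 1 / n : ℝ) := by
    rw [sub_pos, div_lt_one hn0]
    linarith
  have hnk : ‖q k - (p k + e / n)‖ = ‖e‖ - ‖e‖ / n := by
    rw [hqk0, h1n, norm_mul, Complex.norm_real, Real.norm_of_nonneg h1n0.le]
    ring
  have hk0 : q k - (p k + e / n) ≠ 0 := by
    rw [← norm_pos_iff, hnk]
    linarith
  refine ⟨hqng, ?_, ?_⟩
  · rw [hqc]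
    intro h
    obtain ⟨j, -, h⟩ := Finset.mem_image.1 h
    by_cases hj : j = k
    · subst hj
      exact hk0 (sub_eq_zero.2 h)
    · have := hfar j hj
      rw [sub_eq_zero.2 h, norm_zero] at this
      linarith
  · rw [hqc]
    have hbot : MulAction.stabilizer Circle (((Finset.univ.image q).image
        (· - (p k + e / n)) : Finset ℂ) : Set ℂ) = ⊥ := by
      rw [eq_bot_iff]
      intro v hv
      have h1 : v • (((Finset.univ.image q).image (· - (p k + e / n)) : Finset ℂ) : Set ℂ) =
        ((Finset.univ.image q).image (· - (p k + e / n)) : Finset ℂ) := hv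
      have h2 : v • (q k - (p k + e / n)) ∈
          v • (((Finset.univ.image q).image (· - (p k + e / n)) : Finset ℂ) : Set ℂ) :=
        Set.smul_mem_smul_set (Finset.mem_coe.2 (Finset.mem_image_of_mem _
          (Finset.mem_image_of_mem _ (Finset.mem_univ _))))
      rw [h1, Finset.mem_coe, Finset.mem_image] at h2
      obtain ⟨x, hx, h2⟩ := h2
      obtain ⟨j, -, rfl⟩ := Finset.mem_image.1 hx
      rw [Circle.smul_def, smul_eq_mul] at h2
      by_cases hj : j = k
      · subst hj
        rw [Subgroup.mem_bot]
        apply Circle.ext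
        rw [Circle.coe_one]
        exact mul_right_cancel₀ hk0 (by rw [← h2, one_mul])
      · have h3 := hfar j hj
        rw [h2, norm_mul, Circle.norm_coe, one_mul, hnk] at h3
        exact absurd h3 (lt_irrefl _)
    rw [hbot]
    simp

/-- A pattern can be formed if there is a plan that leads to it from a small configuration with
sufficient rotational symmetry. -/
theorem canBeFormed_of_plan [Fintype ι] (E : ExpansionPlan ι) {P : Finset ℂ} (hP : 2 ≤ P.card)
    (hι : Fintype.card ι = P.card)
    (h0 : ∃ b : ℂ, (P : Set ℂ) = Set.range fun i => E.pos 0 i + b) {N : ℕ}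
    (hinj : Function.Injective (E.pos N)) (hne : ∀ i, E.pos N i ≠ 0)
    (hN : ∀ i, P.card * ‖E.pos N i‖ ≤ 1)
    (hrot : ∀ w : ℂ, w ^ symmetricity P = 1 → ∀ i, ∃ j, w * E.pos N i = E.pos N j) :
    CanBeFormed P := by
  obtain ⟨F, hF⟩ := exists_equivariant_assignment (m := symmetricity P)
    (n := P.card) (Y := Finset.univ.image (E.pos N)) (by omega)
    (by rw [Finset.card_image_of_injective _ hinj, Finset.card_univ, hι])
    (by simpa using hne)
    (by
      intro w hw x hx
      obtain ⟨i, -, rfl⟩ := Finset.mem_image.1 hx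
      obtain ⟨j, hj⟩ := hrot w hw i
      rw [hj]
      exact Finset.mem_image_of_mem _ (Finset.mem_univ _))
  simp only [Finset.coe_image, Finset.coe_univ, Set.image_univ] at hF
  have hF' : ∀ X : Finset ℂ, X.card = P.card → (0 : ℂ) ∉ X →
      Nat.card (MulAction.stabilizer Circle (X : Set ℂ)) ∣ symmetricity P →
      (∀ (u : Circle) (x : ℂ), F (u • (X : Set ℂ)) (u * x) = u * F X x) ∧
      ∃ v : Circle, F X '' X = v • Set.range (E.pos N) := hF
  refine ⟨planProtocol E P.card F, fun p hp hsym u => ?_⟩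
  -- If no level were ever reached, the robots would obey the gathering rule for as long as needed,
  -- and that rule reaches level `N` after one or two cycles.
  have hreach : ∃ t l, E.AtLevel l ((planProtocol E P.card F).run u p t) := by
    by_contra hcon
    push Not at hcon
    have hl0 := hcon 0
    by_cases hc : centroid (Finset.univ.image p) ∈ Finset.univ.image p
    · obtain ⟨h1, h2, h3⟩ := nearGathering_step_of_centroid_mem hι hP hp hl0 hc (u 0) rfl
      exact hcon 2 N (atLevel_step_of_nearGathering hι hN hF' h1 (hcon 1) h2
        (by rw [h3]; exact one_dvd _) (u 1))
    · have hne' : (Finset.univ.image p).Nonempty := by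
        rw [← Finset.card_pos, card_univ_image hp.1]
        omega
      exact hcon 1 N (atLevel_step_of_nearGathering hι hN hF' hp hl0 hc
        ((card_stabilizer_dvd_symmetricity hne' hc).trans hsym) (u 0))
  obtain ⟨t, l, h⟩ := hreach
  obtain ⟨T, ⟨a, b, hT⟩, hrest⟩ := exists_halt_of_atLevel h
  obtain ⟨c, hc⟩ := h0
  refine ⟨T, ⟨a, b - a * c, ?_⟩, hrest⟩
  rw [hT, hc, ← Set.range_comp]
  congr 1
  funext i
  simp only [Function.comp_apply]
  ring

end

/-! ### Unions of regular polygons and the choice of the scales -/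

/-- The configuration of regular `m`-gons around the origin through the points `b s`. -/
def orb {S : Type*} (m : ℕ) (b : S → ℂ) (i : S × nthRootsFinset m (1 : ℂ)) : ℂ := b i.1 * i.2

/-- The trivial root of unity. -/
def oneRoot {m : ℕ} (hm : 0 < m) : nthRootsFinset m (1 : ℂ) := ⟨1, (mem_roots hm).2 (one_pow m)⟩

theorem orb_oneRoot {S : Type*} {m : ℕ} (hm : 0 < m) (b : S → ℂ) (s : S) :
    orb m b (s, oneRoot hm) = b s := mul_one _

theorem exists_circle_of_root {m : ℕ} (hm : 0 < m) (w : nthRootsFinset m (1 : ℂ)) :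
    ∃ u : Circle, (u : ℂ) = w :=
  ⟨⟨w, by simp [Submonoid.unitSphere, norm_of_pow_eq_one hm ((mem_roots hm).1 w.2)]⟩, rfl⟩

/-- The configuration is invariant under multiplication by `w`. Questions about views thereby reduce
to the base points. -/
theorem view_orb {S : Type*} {m : ℕ} (hm : 0 < m) (b : S → ℂ) (s : S)
    (w : nthRootsFinset m (1 : ℂ)) {u : Circle} (hu : (u : ℂ) = w) :
    view (orb m b) (s, w) = u • view (orb m b) (s, oneRoot hm) := by
  have hu0 := Circle.coe_ne_zero u
  have hw := (mem_roots hm).1 w.2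
  rw [← hu] at hw
  ext z
  refine Iff.trans ?_ Set.mem_smul_set_iff_inv_smul_mem.symm
  have hz : u⁻¹ • z = (u : ℂ)⁻¹ * z := by rw [Circle.smul_def, smul_eq_mul, Circle.coe_inv]
  have hn : ‖(u : ℂ)⁻¹ * z‖ = ‖z‖ := by rw [norm_mul, norm_inv, Circle.norm_coe, inv_one, one_mul]
  rw [hz]
  simp only [view, Set.mem_ofPred_eq, hn, orb_oneRoot]
  refine and_congr_right fun _ => ?_
  simp only [orb, ← hu]
  constructor
  · rintro ⟨⟨s', v⟩, h⟩
    refine ⟨(s', ⟨(u : ℂ)⁻¹ * v, (mem_roots hm).2 ?_⟩), ?_⟩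
    · rw [mul_pow, inv_pow, hw, (mem_roots hm).1 v.2, inv_one, one_mul]
    · simp only at h ⊢
      field_simp
      linear_combination h
  · rintro ⟨⟨s', v⟩, h⟩
    refine ⟨(s', ⟨(u : ℂ) * v, (mem_roots hm).2 ?_⟩), ?_⟩
    · rw [mul_pow, hw, (mem_roots hm).1 v.2, one_mul]
    · simp only at h ⊢
      field_simp at h
      linear_combination h

/-- `δ` is the distance from the `i`-th point of `w` to the nearest other point. -/
def IsNearest {ι : Type*} (w : ι → ℂ) (i : ι) (δ : ℝ) : Prop :=
  IsLeast {r | ∃ j, w j ≠ w i ∧ r = ‖w j - w i‖} δ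

/-- A nearest point at distance at most 1 is visible, so the distance to it can be read off the
view. This is how a robot determines its level. -/
theorem IsNearest.le_of_view_eq {ι : Type*} {w w' : ι → ℂ} {i i' : ι} {u : Circle} {δ δ' : ℝ}
    (h : view w i = u • view w' i') (hδ : IsNearest w i δ) (hδ' : IsNearest w' i' δ')
    (h' : δ' ≤ 1) : δ ≤ δ' := by
  obtain ⟨j, hj, rfl⟩ := hδ'.1
  have h1 : w' j - w' i' ∈ view w' i' := ⟨h', j, by ring⟩
  have h2 : u • (w' j - w' i') ∈ view w i := by
    rw [h]
    exact Set.smul_mem_smul_set h1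
  obtain ⟨-, k, hk⟩ := h2
  rw [Circle.smul_def, smul_eq_mul] at hk
  have h3 : w k - w i = u * (w' j - w' i') := by rw [← hk]; ring
  refine hδ.2 ⟨k, ?_, ?_⟩
  · rw [← sub_ne_zero, h3]
    exact mul_ne_zero (Circle.coe_ne_zero u) (sub_ne_zero.2 hj)
  · rw [h3, norm_mul, Circle.norm_coe, one_mul]

theorem IsNearest.eq_of_view_eq {ι : Type*} {w w' : ι → ℂ} {i i' : ι} {u : Circle} {δ δ' : ℝ}
    (h : view w i = u • view w' i') (hδ : IsNearest w i δ) (hδ' : IsNearest w' i' δ')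
    (h1 : δ ≤ 1) (h1' : δ' ≤ 1) : δ = δ' :=
  le_antisymm (hδ.le_of_view_eq h hδ' h1')
    (hδ'.le_of_view_eq (u := u⁻¹) (by rw [h, inv_smul_smul]) hδ h1)

theorem exists_isNearest {ι : Type*} [Finite ι] {w : ι → ℂ} {i : ι}
    (h : ∃ j, w j ≠ w i) : ∃ δ, 0 < δ ∧ IsNearest w i δ := by
  obtain ⟨j₀, hj₀⟩ := h
  obtain ⟨j, hj, hmin⟩ := Set.exists_min_image {j | w j ≠ w i} (fun j => ‖w j - w i‖)
    (Set.toFinite _) ⟨j₀, hj₀⟩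
  refine ⟨‖w j - w i‖, norm_pos_iff.2 (sub_ne_zero.2 hj), ⟨j, hj, rfl⟩, ?_⟩
  rintro r ⟨k, hk, rfl⟩
  exact hmin k hk

theorem IsNearest.scale {S : Type*} {m : ℕ} {b : S → ℂ}
    {i : S × nthRootsFinset m (1 : ℂ)} {δ c : ℝ} (h : IsNearest (orb m b) i δ) (hc : 0 < c) :
    IsNearest (orb m fun s => (c : ℂ) * b s) i (c * δ) := by
  have hc0 : (c : ℂ) ≠ 0 := by exact_mod_cast hc.ne'
  have ho : ∀ j, orb m (fun s => (c : ℂ) * b s) j = c * orb m b j := fun j => mul_assoc _ _ _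
  have hn : ∀ j, ‖(c : ℂ) * orb m b j - c * orb m b i‖ = c * ‖orb m b j - orb m b i‖ := fun j => by
    rw [← mul_sub, norm_mul, Complex.norm_real, Real.norm_of_nonneg hc.le]
  obtain ⟨⟨j, hj, rfl⟩, hmin⟩ := h
  simp only [IsNearest, ho, hn]
  refine ⟨⟨j, fun h => hj (mul_left_cancel₀ hc0 h), rfl⟩, ?_⟩
  rintro r ⟨k, hk, rfl⟩
  exact mul_le_mul_of_nonneg_left (hmin ⟨k, fun h => hk (by rw [h]), rfl⟩) hc.le

/-- Each pair of an exponent and a forbidden value excludes at most one nonnegative `q`, so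
countably many are excluded, while an interval has positive measure. -/
theorem exists_pow_notMem (T : Finset ℝ) {a b : ℝ} (ha : 0 ≤ a) (hab : a < b) :
    ∃ q, a < q ∧ q < b ∧ ∀ k : ℕ, k ≠ 0 → q ^ k ∉ T := by
  by_contra hcon
  push Not at hcon
  have hsub : Set.Ioo a b ⊆ ⋃ k : ℕ, ⋃ t ∈ T, {q : ℝ | 0 ≤ q ∧ k ≠ 0 ∧ q ^ k = t} := by
    intro q hq
    obtain ⟨k, hk, h⟩ := hcon q hq.1 hq.2
    simp only [Set.mem_iUnion]
    exact ⟨k, q ^ k, h, ha.trans hq.1.le, hk, rfl⟩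
  have hcount : (⋃ k : ℕ, ⋃ t ∈ T, {q : ℝ | 0 ≤ q ∧ k ≠ 0 ∧ q ^ k = t}).Countable := by
    refine Set.countable_iUnion fun k => T.countable_toSet.biUnion fun t _ => ?_
    refine Set.Subsingleton.countable ?_
    rintro x ⟨hx, hk, h⟩ y ⟨hy, -, h'⟩
    exact (pow_left_inj₀ hx hy hk).1 (h.trans h'.symm)
  have h := (hcount.mono hsub).measure_zero MeasureTheory.volume
  rw [Real.volume_Ioo, ENNReal.ofReal_eq_zero] at h
  linarith

/-- The base points of the configurations of the plan. -/
def planBase {S : Type*} (a b : S → ℂ) (c q : ℝ) : ℕ → S → ℂ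
  | 0 => a
  | k + 1 => fun s => ((c * q ^ k : ℝ) : ℂ) * b s

/-- A pattern of regular `m`-gons can be formed if there are arbitrarily small configurations of
regular `m`-gons in which every robot sees another one and in which robots in different gons
have different views. -/
theorem canBeFormed_of_generic {S : Type*} [Fintype S] {P : Finset ℂ} (hP : 2 ≤ P.card) {m : ℕ}
    (hm : 0 < m) (hmP : symmetricity P = m) (hcard : Fintype.card S * m = P.card) {a b : S → ℂ}
    (h0 : ∃ z : ℂ, (P : Set ℂ) = Set.range fun i => orb m a i + z)
    (hb0 : ∀ s, b s ≠ 0) (hbinj : Function.Injective (orb m b)) {c₁ c₀ : ℝ} (hc₁ : 0 < c₁)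
    (hc : c₁ < c₀) (hstep : ∀ c, c₁ < c → c < c₀ → ∀ s, ‖a s - c * b s‖ ≤ 1)
    (hva : ∀ s, ∃ j, orb m a j ≠ a s ∧ ‖orb m a j - a s‖ ≤ 1)
    (hvb : ∀ s, ∃ j, orb m b j ≠ b s ∧ c₀ * ‖orb m b j - b s‖ ≤ 1)
    (hgen : ∀ c : ℝ, 0 < c → c ≤ c₀ → ∀ s s' (u : Circle),
      view (orb m fun s => (c : ℂ) * b s) (s, oneRoot hm) =
        u • view (orb m fun s => (c : ℂ) * b s) (s', oneRoot hm) → s = s' ∧ u = 1) :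
    CanBeFormed P := by
  classical
  have hna : ∀ s, ∃ δ, 0 < δ ∧ δ ≤ 1 ∧ IsNearest (orb m a) (s, oneRoot hm) δ := by
    intro s
    obtain ⟨j, hj, hj1⟩ := hva s
    obtain ⟨δ, h1, h2⟩ := exists_isNearest (w := orb m a) (i := (s, oneRoot hm))
      ⟨j, by rwa [orb_oneRoot]⟩
    exact ⟨δ, h1, (h2.2 ⟨j, by rwa [orb_oneRoot], rfl⟩).trans (by rwa [orb_oneRoot]), h2⟩
  have hnb : ∀ s, ∃ δ, 0 < δ ∧ c₀ * δ ≤ 1 ∧ IsNearest (orb m b) (s, oneRoot hm) δ := by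
    intro s
    obtain ⟨j, hj, hj1⟩ := hvb s
    obtain ⟨δ, h1, h2⟩ := exists_isNearest (w := orb m b) (i := (s, oneRoot hm))
      ⟨j, by rwa [orb_oneRoot]⟩
    refine ⟨δ, h1, le_trans (mul_le_mul_of_nonneg_left
      (h2.2 ⟨j, by rwa [orb_oneRoot], rfl⟩) (hc₁.trans hc).le) (by rwa [orb_oneRoot]), h2⟩
  choose δ hδ0 hδ1 hδ using hna
  choose η hη0 hη1 hη using hnb
  -- Only the exponent 1 is used: no nearest-neighbor distance of level 1 may occur at level 0.
  obtain ⟨c, hc1, hc0, hcT⟩ := exists_pow_notMem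
    (Finset.univ.image fun x : S × S => δ x.1 / η x.2) hc₁.le hc
  have hcpos : 0 < c := hc₁.trans hc1
  have hcne : ∀ s s', c * η s' ≠ δ s := by
    intro s s' h
    refine hcT 1 one_ne_zero (Finset.mem_image.2 ⟨(s, s'), Finset.mem_univ _, ?_⟩)
    rw [← h, pow_one]
    exact mul_div_cancel_right₀ _ (hη0 s').ne'
  set M := ∑ s, c * ‖b s‖
  have hM : ∀ s, c * ‖b s‖ ≤ M := fun s =>
    Finset.single_le_sum (f := fun s => c * ‖b s‖)
      (fun s _ => mul_nonneg hcpos.le (norm_nonneg _)) (Finset.mem_univ s)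
  have hM0 : 0 ≤ M := Finset.sum_nonneg fun s _ => mul_nonneg hcpos.le (norm_nonneg _)
  -- The bound q > M / (M + 1) yields (1 - q) M ≤ 1, so that a step between consecutive scaled
  -- levels has length at most 1. The excluded values keep the nearest-neighbor distances of
  -- different levels apart, for all pairs of gons.
  obtain ⟨q, hq1, hq0, hqT⟩ := exists_pow_notMem
    ((Finset.univ.image fun x : S × S => δ x.1 / (c * η x.2)) ∪
      Finset.univ.image fun x : S × S => η x.1 / η x.2) (a := M / (M + 1)) (b := 1) (by positivity)
    (by rw [div_lt_one (by positivity)]; linarith)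
  have hqpos : 0 < q := lt_of_le_of_lt (by positivity) hq1
  have hqk : ∀ k, 0 < q ^ k := fun k => pow_pos hqpos k
  have hqk1 : ∀ k, q ^ k ≤ 1 := fun k => pow_le_one₀ hqpos.le hq0.le
  have hqM : (1 - q) * M ≤ 1 := by
    rw [div_lt_iff₀ (by positivity)] at hq1
    nlinarith
  have hqa : ∀ k s s', c * q ^ k * η s' ≠ δ s := by
    intro k s s' h
    rcases Nat.eq_zero_or_pos k with rfl | hk
    · exact hcne s s' (by simpa using h)
    · refine hqT k hk.ne' (Finset.mem_union_left _
        (Finset.mem_image.2 ⟨(s, s'), Finset.mem_univ _, ?_⟩))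
      have := (hη0 s').ne'
      simp only [← h]
      field_simp
  have hqb : ∀ k k', k < k' → ∀ s s', c * q ^ k' * η s' ≠ c * q ^ k * η s := by
    intro k k' hk s s' h
    refine hqT (k' - k) (Nat.sub_ne_zero_of_lt hk) (Finset.mem_union_right _
      (Finset.mem_image.2 ⟨(s, s'), Finset.mem_univ _, ?_⟩))
    obtain ⟨d, rfl⟩ := Nat.exists_eq_add_of_lt hk
    have h1 : k + d + 1 - k = d + 1 := by omega
    simp only [h1]
    rw [div_eq_iff (hη0 s').ne']
    have h2 : c * q ^ k * (q ^ (d + 1) * η s') = c * q ^ k * η s := by rw [← h]; ring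
    exact (mul_left_cancel₀ (mul_pos hcpos (hqk k)).ne' h2).symm
  have hscale : ∀ k, 0 < c * q ^ k ∧ c * q ^ k ≤ c₀ := fun k =>
    ⟨mul_pos hcpos (hqk k), (mul_le_of_le_one_right hcpos.le (hqk1 k)).trans hc0.le⟩
  have hnear : ∀ l s, ∃ D, D ≤ 1 ∧
      IsNearest (orb m (planBase a b c q l)) (s, oneRoot hm) D ∧
      D = match l with | 0 => δ s | k + 1 => c * q ^ k * η s := by
    rintro (_ | k) s
    · exact ⟨_, hδ1 s, hδ s, rfl⟩
    · exact ⟨_, (mul_le_mul_of_nonneg_right (hscale k).2 (hη0 s).le).trans (hη1 s),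
        (hη s).scale (hscale k).1, rfl⟩
  have hbase : ∀ l l' s s' (u : Circle),
      view (orb m (planBase a b c q l)) (s, oneRoot hm) =
        u • view (orb m (planBase a b c q l')) (s', oneRoot hm) →
      planBase a b c q (l - 1) s - planBase a b c q l s =
        u * (planBase a b c q (l' - 1) s' - planBase a b c q l' s') := by
    intro l l' s s' u h
    obtain ⟨D, hD1, hD, hDe⟩ := hnear l s
    obtain ⟨D', hD1', hD', hDe'⟩ := hnear l' s'
    have heq := hD.eq_of_view_eq h hD' hD1 hD1'
    rcases l with _ | k <;> rcases l' with _ | k'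
    -- Both robots are at level 0, where 0 - 1 = 0 makes both moves vanish; their views may
    -- coincide.
    · simp
    · exact absurd (heq.symm.trans hDe) (hDe' ▸ hqa k' s s')
    · exact absurd (heq.trans hDe') (hDe ▸ hqa k s' s)
    · have hkk : k = k' := by
        by_contra hne
        rcases Nat.lt_or_gt_of_ne hne with hlt | hlt
        · exact hqb k k' hlt s s' (by simp only at hDe hDe'; rw [← hDe, ← hDe', heq])
        · exact hqb k' k hlt s' s (by simp only at hDe hDe'; rw [← hDe, ← hDe', heq])
      subst hkk
      obtain ⟨rfl, rfl⟩ := hgen _ (hscale k).1 (hscale k).2 s s' u h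
      rw [Circle.coe_one, one_mul]
  have hnorm : ∀ l s, ‖planBase a b c q (l - 1) s - planBase a b c q l s‖ ≤ 1 := by
    rintro (_ | _ | k) s
    · simp
    · simpa [planBase] using hstep c hc1 hc0 s
    · have h1 : planBase a b c q (k + 1 + 1 - 1) s - planBase a b c q (k + 1 + 1) s =
          ((q ^ k * ((1 - q) * c) : ℝ) : ℂ) * b s := by
        simp only [planBase, Nat.add_sub_cancel]
        push_cast
        ring
      rw [h1, norm_mul, Complex.norm_real, Real.norm_of_nonneg
        (mul_nonneg (hqk k).le (mul_nonneg (by linarith) hcpos.le)), mul_assoc, mul_assoc]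
      refine (mul_le_of_le_one_left ?_ (hqk1 k)).trans
        ((mul_le_mul_of_nonneg_left (hM s) (by linarith)).trans hqM)
      exact mul_nonneg (by linarith) (mul_nonneg hcpos.le (norm_nonneg _))
  let E : ExpansionPlan (S × nthRootsFinset m (1 : ℂ)) :=
    { pos := fun l => orb m (planBase a b c q l)
      norm_le := by
        rintro l ⟨s, w⟩
        simp only [orb, ← sub_mul, norm_mul]
        rw [norm_of_pow_eq_one hm ((mem_roots hm).1 w.2), mul_one]
        exact hnorm l s
      consistent := by
        rintro l l' ⟨s, w⟩ ⟨s', w'⟩ u h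
        obtain ⟨v, hv⟩ := exists_circle_of_root hm w
        obtain ⟨v', hv'⟩ := exists_circle_of_root hm w'
        rw [view_orb hm _ s w hv, view_orb hm _ s' w' hv'] at h
        have h1 : view (orb m (planBase a b c q l)) (s, oneRoot hm) =
            (v⁻¹ * u * v') • view (orb m (planBase a b c q l')) (s', oneRoot hm) := by
          rw [mul_smul, mul_smul, ← h, inv_smul_smul]
        have h2 := hbase l l' s s' _ h1
        simp only [orb, ← sub_mul, h2, ← hv, ← hv']
        push_cast
        have := Circle.coe_ne_zero v
        field_simp }
  -- A level so small that all its points are within 1 / |P| of the origin, as the gathering step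
  -- demands.
  obtain ⟨k, hk⟩ := exists_pow_lt_of_lt_one (y := q) (x := 1 / (P.card * M + 1))
    (by positivity) hq0
  have hscale0 : ((c * q ^ k : ℝ) : ℂ) ≠ 0 := by exact_mod_cast (hscale k).1.ne'
  have horb : ∀ i, E.pos (k + 1) i = ((c * q ^ k : ℝ) : ℂ) * orb m b i := fun i => mul_assoc _ _ _
  refine canBeFormed_of_plan E hP ?_ h0 (N := k + 1) ?_ ?_ ?_ ?_
  · rw [Fintype.card_prod, Fintype.card_coe, card_roots hm, hcard]
  · intro i j hij
    rw [horb, horb] at hij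
    exact hbinj (mul_left_cancel₀ hscale0 hij)
  · intro i
    rw [horb]
    refine mul_ne_zero hscale0 (mul_ne_zero (hb0 _) ?_)
    rw [← norm_ne_zero_iff, norm_of_pow_eq_one hm ((mem_roots hm).1 i.2.2)]
    exact one_ne_zero
  · intro i
    rw [horb, norm_mul, Complex.norm_real, Real.norm_of_nonneg (hscale k).1.le, orb, norm_mul,
      norm_of_pow_eq_one hm ((mem_roots hm).1 i.2.2), mul_one]
    rw [lt_div_iff₀ (by positivity)] at hk
    have h1 : c * q ^ k * ‖b i.1‖ ≤ q ^ k * M := by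
      have := mul_le_mul_of_nonneg_left (hM i.1) (hqk k).le
      linarith
    have h2 : (P.card : ℝ) * (c * q ^ k * ‖b i.1‖) ≤ P.card * (q ^ k * M) :=
      mul_le_mul_of_nonneg_left h1 (Nat.cast_nonneg _)
    have := hqk k
    linarith
  · rintro w hw ⟨s, v⟩
    rw [hmP] at hw
    refine ⟨(s, ⟨w * v, (mem_roots hm).2 ?_⟩), ?_⟩
    · rw [mul_pow, hw, (mem_roots hm).1 v.2, one_mul]
    · rw [horb, horb]
      simp only [orb]
      ring

/-! ### Telling the views from two polygons apart -/

/-- The points of the regular `m`-gon through `y` that are visible from `x`. -/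
def visible (m : ℕ) (y x : ℂ) : Finset ℂ :=
  (nthRootsFinset m (1 : ℂ)).filter fun w => ‖y * w - x‖ ≤ 1

/-- Equal views have equal sums of any function over the visible points; `f` will be 1, |z|² and z.
-/
theorem sum_of_view_eq {ι : Type*} [Fintype ι] {w w' : ι → ℂ} (hw : Function.Injective w)
    (hw' : Function.Injective w') {i i' : ι} {u : Circle} (h : view w i = u • view w' i')
    (f : ℂ → ℂ) : ∑ j with ‖w j - w i‖ ≤ 1, f (w j - w i) =
      ∑ j with ‖w' j - w' i'‖ ≤ 1, f (u * (w' j - w' i')) := by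
  have hu := Circle.coe_ne_zero u
  have himg : (Finset.univ.filter fun j => ‖w j - w i‖ ≤ 1).image (fun j => w j - w i) =
      (Finset.univ.filter fun j => ‖w' j - w' i'‖ ≤ 1).image fun j => u * (w' j - w' i') := by
    ext z
    have h1 : z ∈ view w i ↔ z ∈ u • view w' i' := by rw [h]
    simp only [Finset.mem_image, Finset.mem_filter, Finset.mem_univ, true_and]
    constructor
    · rintro ⟨j, hj, rfl⟩
      obtain ⟨y, ⟨hy, k, hk⟩, hyz⟩ := h1.1 ⟨hj, j, by ring⟩
      have hy' : y = w' k - w' i' := by rw [← hk]; ring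
      exact ⟨k, hy' ▸ hy, by rw [← hy']; exact hyz⟩
    · rintro ⟨k, hk, rfl⟩
      obtain ⟨hz, j, hj⟩ := h1.2 ⟨w' k - w' i', ⟨hk, k, by ring⟩, rfl⟩
      have hj' : (u : ℂ) * (w' k - w' i') = w j - w i := by rw [← hj]; ring
      exact ⟨j, hj' ▸ hz, hj'.symm⟩
  rw [← Finset.sum_image (f := f) (g := fun j => w j - w i) fun a _ b _ hab =>
    hw (sub_left_inj.1 hab), himg, Finset.sum_image fun a _ b _ hab =>
    hw' (sub_left_inj.1 (mul_left_cancel₀ hu hab))]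

theorem sum_visible {S : Type*} [Fintype S] {m : ℕ} (b : S → ℂ) (x : ℂ) (f : ℂ → ℂ) :
    ∑ j with ‖orb m b j - x‖ ≤ 1, f (orb m b j - x) =
      ∑ s, ∑ w ∈ visible m (b s) x, f (b s * w - x) := by
  rw [Finset.sum_filter, Fintype.sum_prod_type]
  refine Finset.sum_congr rfl fun s _ => ?_
  rw [visible, Finset.sum_filter]
  exact Finset.sum_coe_sort (nthRootsFinset m (1 : ℂ)) fun w =>
    if ‖b s * w - x‖ ≤ 1 then f (b s * w - x) else 0

/-- Visibility is symmetric: `x * w` is seen from `y` exactly if `y * w⁻¹` is seen from `x`. -/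
theorem sum_visible_swap {m : ℕ} (hm : 0 < m) (x y : ℂ) (g : ℂ → ℂ) :
    ∑ w ∈ visible m x y, g w = ∑ w ∈ visible m y x, g w⁻¹ := by
  have key : ∀ x y w : ℂ, w ∈ visible m x y → w⁻¹ ∈ visible m y x := by
    intro x y w hw
    rw [visible, Finset.mem_filter, mem_roots hm] at hw ⊢
    have hn := norm_of_pow_eq_one hm hw.1
    have hw0 : w ≠ 0 := norm_ne_zero_iff.1 (by rw [hn]; exact one_ne_zero)
    refine ⟨by rw [inv_pow, hw.1, inv_one], ?_⟩
    have h1 : y * w⁻¹ - x = -(w⁻¹ * (x * w - y)) := by field_simp; ring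
    rw [h1, norm_neg, norm_mul, norm_inv, hn, inv_one, one_mul]
    exact hw.2
  exact Finset.sum_nbij' (·⁻¹) (·⁻¹) (key x y) (key y x) (by simp) (by simp) (by simp)

theorem card_visible_swap {m : ℕ} (hm : 0 < m) (x y : ℂ) :
    (visible m x y).card = (visible m y x).card := by
  have := sum_visible_swap hm x y fun _ => 1
  simpa using this

theorem re_lt_one_of_root {m : ℕ} (hm : 0 < m) {w : ℂ} (hw : w ^ m = 1) (h1 : w ≠ 1) :
    w.re < 1 := by
  have hn := norm_of_pow_eq_one hm hw
  refine lt_of_le_of_ne (hn ▸ Complex.re_le_norm w) fun hre => h1 ?_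
  have h2 := Complex.normSq_eq_norm_sq w
  rw [hn, Complex.normSq_apply, hre] at h2
  have him : w.im = 0 := by
    have : w.im * w.im = 0 := by linarith
    exact mul_self_eq_zero.1 this
  exact Complex.ext hre him

/-- Two distinct unit vectors have a sum shorter than 2 by the parallelogram law; the others
contribute at most 1 each. -/
theorem norm_sum_roots_lt {m : ℕ} (hm : 0 < m) {J : Finset ℂ} (hJ : ∀ w ∈ J, w ^ m = 1)
    (h2 : 2 ≤ J.card) : ‖∑ w ∈ J, w‖ < J.card := by
  obtain ⟨v, hv, w, hw, hvw⟩ := Finset.one_lt_card.1 h2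
  have hnv := norm_of_pow_eq_one hm (hJ v hv)
  have hnw := norm_of_pow_eq_one hm (hJ w hw)
  have hpar := parallelogram_law_with_norm ℝ v w
  have hpos : 0 < ‖v - w‖ := norm_pos_iff.2 (sub_ne_zero.2 hvw)
  rw [hnv, hnw] at hpar
  have hlt : ‖v + w‖ < 2 := by nlinarith [norm_nonneg (v + w)]
  have hw' : w ∈ J.erase v := Finset.mem_erase.2 ⟨hvw.symm, hw⟩
  rw [← Finset.add_sum_erase _ _ hv, ← Finset.add_sum_erase _ _ hw', ← add_assoc]
  have hrest : ‖∑ z ∈ (J.erase v).erase w, z‖ ≤ J.card - 2 := by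
    refine (norm_sum_le _ _).trans ?_
    rw [Finset.sum_congr rfl fun z hz => norm_of_pow_eq_one hm
      (hJ z (Finset.mem_of_mem_erase (Finset.mem_of_mem_erase hz))), Finset.sum_const,
      Finset.card_erase_of_mem hw', Finset.card_erase_of_mem hv, nsmul_eq_mul, mul_one,
      Nat.sub_sub, Nat.cast_sub h2]
    norm_num
  linarith [norm_add_le (v + w) (∑ z ∈ (J.erase v).erase w, z)]

/-- Points of two regular polygons with different radii have different views. -/
theorem false_of_matching_views {m : ℕ} (hm : 0 < m) {x y : ℂ} (hxy : ‖x‖ < ‖y‖) {u : Circle}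
    (h : ∀ f : ℂ → ℂ,
      ∑ w ∈ visible m x x, f (x * w - x) + ∑ w ∈ visible m y x, f (y * w - x) =
      ∑ w ∈ visible m y y, f (u * (y * w - y)) + ∑ w ∈ visible m x y, f (u * (x * w - y)))
    (hconn : (∃ w ∈ visible m x x, w ≠ 1) ∨ (∃ w ∈ visible m y y, w ≠ 1) ∨
      2 ≤ (visible m y x).card) : False := by
  have hroot : ∀ a b w, w ∈ visible m a b → w ^ m = 1 := fun a b w hw =>
    (mem_roots hm).1 (Finset.mem_filter.1 hw).1
  have hsq : ‖x‖ ^ 2 < ‖y‖ ^ 2 := by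
    have := norm_nonneg x
    nlinarith
  have hsub : visible m y y ⊆ visible m x x := by
    intro w hw
    rw [visible, Finset.mem_filter] at hw ⊢
    refine ⟨hw.1, le_trans ?_ hw.2⟩
    rw [← mul_sub_one, ← mul_sub_one, norm_mul, norm_mul]
    exact mul_le_mul_of_nonneg_right hxy.le (norm_nonneg _)
  -- Counting: the two gons see equally many points of each other, so each sees equally many of its
  -- own. Since chords are longer on the larger circle, the visible roots then coincide.
  have hcard : (visible m x x).card = (visible m y y).card := by
    have h1 := h fun _ => 1
    simp only [Finset.sum_const, nsmul_eq_mul, mul_one] at h1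
    rw [card_visible_swap hm x y] at h1
    exact_mod_cast add_right_cancel h1
  have heq : visible m y y = visible m x x := Finset.eq_of_subset_of_card_le hsub hcard.le
  -- Second moments: the cross distances cancel, and the sums over the own gon have the factors |x|²
  -- and |y|². They agree only if both vanish, so neither point sees another point of its own gon.
  have hone : ∀ w ∈ visible m x x, w = 1 := by
    have h1 := h fun z => ((‖z‖ ^ 2 : ℝ) : ℂ)
    rw [sum_visible_swap hm x y, heq] at h1
    have h2 : ∑ w ∈ visible m y x, ((‖(u : ℂ) * (x * w⁻¹ - y)‖ ^ 2 : ℝ) : ℂ) =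
        ∑ w ∈ visible m y x, ((‖y * w - x‖ ^ 2 : ℝ) : ℂ) := by
      refine Finset.sum_congr rfl fun w hw => ?_
      have hn := norm_of_pow_eq_one hm (hroot _ _ w hw)
      have hw0 : w ≠ 0 := norm_ne_zero_iff.1 (by rw [hn]; exact one_ne_zero)
      have h3 : x * w⁻¹ - y = -(w⁻¹ * (y * w - x)) := by field_simp; ring
      rw [norm_mul, Circle.norm_coe, one_mul, h3, norm_neg, norm_mul, norm_inv, hn, inv_one,
        one_mul]
    rw [h2] at h1
    have h3 := add_right_cancel h1
    rw [← Complex.ofReal_sum, ← Complex.ofReal_sum, Complex.ofReal_inj] at h3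
    have h4 : ∀ w : ℂ, ‖(u : ℂ) * (y * w - y)‖ ^ 2 = ‖y‖ ^ 2 * ‖w - 1‖ ^ 2 := fun w => by
      rw [norm_mul, Circle.norm_coe, one_mul, ← mul_sub_one, norm_mul, mul_pow]
    have h5 : ∀ w : ℂ, ‖x * w - x‖ ^ 2 = ‖x‖ ^ 2 * ‖w - 1‖ ^ 2 := fun w => by
      rw [← mul_sub_one, norm_mul, mul_pow]
    simp only [h4, h5, ← Finset.mul_sum] at h3
    have h6 : ∑ w ∈ visible m x x, ‖w - 1‖ ^ 2 = 0 := by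
      have : (‖y‖ ^ 2 - ‖x‖ ^ 2) * ∑ w ∈ visible m x x, ‖w - 1‖ ^ 2 = 0 := by linarith
      exact (mul_eq_zero.1 this).resolve_left (by linarith)
    intro w hw
    have h7 := (Finset.sum_eq_zero_iff_of_nonneg fun w _ => sq_nonneg ‖w - 1‖).1 h6 w hw
    exact sub_eq_zero.1 (norm_eq_zero.1 (pow_eq_zero_iff two_ne_zero |>.1 h7))
  rcases hconn with ⟨w, hw, hw1⟩ | ⟨w, hw, hw1⟩ | h2
  · exact hw1 (hone w hw)
  · exact hw1 (hone w (hsub hw))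
  · have hz : ∀ (a : ℂ) (v : ℂ), ∑ w ∈ visible m x x, v * (a * w - a) = 0 := fun a v =>
      Finset.sum_eq_zero fun w hw => by rw [hone w hw]; ring
    have h1 := h fun z => z
    rw [heq, hz, zero_add, sum_visible_swap hm x y] at h1
    have hz1 := hz x 1
    simp only [one_mul] at hz1
    rw [hz1, zero_add] at h1
    have hJ : ∀ w ∈ visible m y x, w ^ m = 1 := hroot y x
    have hlt := norm_sum_roots_lt hm hJ h2
    set J := visible m y x
    set s := ∑ w ∈ J, w
    have hinv : ∑ w ∈ J, w⁻¹ = (starRingEnd ℂ) s := by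
      rw [map_sum]
      exact Finset.sum_congr rfl fun w hw => (conj_eq_inv_of_root hm (hJ w hw)).symm
    have hl : ∑ w ∈ J, (y * w - x) = y * s - (J.card : ℝ) * x := by
      rw [Finset.sum_sub_distrib, ← Finset.mul_sum, Finset.sum_const, nsmul_eq_mul]
      simp [s]
    have hr : ∑ w ∈ J, (u : ℂ) * (x * w⁻¹ - y) =
        u * (x * (starRingEnd ℂ) s - (J.card : ℝ) * y) := by
      rw [← Finset.mul_sum, Finset.sum_sub_distrib, ← Finset.mul_sum, hinv, Finset.sum_const,
        nsmul_eq_mul]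
      simp
    rw [hl, hr] at h1
    have h3 := congrArg Complex.normSq h1
    rw [map_mul, Circle.normSq_coe, one_mul] at h3
    -- First moments: with only cross neighbors left, the two vector sums have equal norms. For k
    -- the number of these neighbors this identity contradicts |x| < |y| and |s| < k; the latter
    -- needs k ≥ 2.
    have hid : ∀ (k : ℝ), Complex.normSq (y * s - k * x) -
        Complex.normSq (x * (starRingEnd ℂ) s - k * y) =
        (Complex.normSq y - Complex.normSq x) * (Complex.normSq s - k ^ 2) := by
      intro k
      simp only [Complex.normSq_apply, Complex.sub_re, Complex.sub_im, Complex.mul_re,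
        Complex.mul_im, Complex.conj_re, Complex.conj_im, Complex.ofReal_re, Complex.ofReal_im]
      ring
    have h4 := hid J.card
    rw [h3, sub_self, Complex.normSq_eq_norm_sq, Complex.normSq_eq_norm_sq,
      Complex.normSq_eq_norm_sq] at h4
    have h5 : ‖s‖ ^ 2 - (J.card : ℝ) ^ 2 < 0 := by
      have := norm_nonneg s
      nlinarith
    exact (mul_neg_of_pos_of_neg (sub_pos.2 hsq) h5).ne h4.symm

/-- No subset of the regular `m`-gons through `x` and `y` that contains more than `x` has center of
mass `x`. -/
def Unbalanced (m : ℕ) (x y : ℂ) : Prop :=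
  ∀ A J : Finset ℂ, (∀ w ∈ A, w ^ m = 1) → (∀ w ∈ J, w ^ m = 1) →
    (∃ w ∈ A, w ≠ 1) ∨ J.Nonempty →
    ∑ w ∈ A, (x * w - x) + ∑ w ∈ J, (y * w - x) ≠ 0

theorem Unbalanced.scale {m : ℕ} {x y c : ℂ} (h : Unbalanced m x y) (hc : c ≠ 0) :
    Unbalanced m (c * x) (c * y) := by
  intro A J hA hJ hne
  have h1 := mul_ne_zero hc (h A J hA hJ hne)
  rw [mul_add, Finset.mul_sum, Finset.mul_sum] at h1
  simpa only [mul_sub, mul_assoc] using h1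

/-- The real part is positive, since Re w < 1 for every root of unity other than 1. -/
theorem weight_ne_zero {m : ℕ} (hm : 0 < m) {A J : Finset ℂ} (hA : ∀ w ∈ A, w ^ m = 1)
    (h : (∃ w ∈ A, w ≠ 1) ∨ J.Nonempty) : (J.card : ℂ) + ∑ w ∈ A, (1 - w) ≠ 0 := by
  have hnn : ∀ w ∈ A, 0 ≤ (1 - w).re := by
    intro w hw
    by_cases h1 : w = 1
    · simp [h1]
    · have := re_lt_one_of_root hm (hA w hw) h1
      simp only [Complex.sub_re, Complex.one_re]
      linarith
  intro h0
  have h1 := congrArg Complex.re h0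
  rw [Complex.add_re, Complex.natCast_re, Complex.re_sum, Complex.zero_re] at h1
  have h2 : 0 ≤ ∑ w ∈ A, (1 - w).re := Finset.sum_nonneg hnn
  rcases h with ⟨w, hw, hw1⟩ | hJ
  · have h3 := Finset.single_le_sum hnn hw
    have h4 := re_lt_one_of_root hm (hA w hw) hw1
    simp only [Complex.sub_re, Complex.one_re] at h3 h1
    have : (0 : ℝ) ≤ J.card := Nat.cast_nonneg _
    linarith
  · have : (0 : ℝ) < J.card := by exact_mod_cast hJ.card_pos
    linarith

theorem balance_eq {x y : ℂ} (A J : Finset ℂ) :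
    ∑ w ∈ A, (x * w - x) + ∑ w ∈ J, (y * w - x) =
      y * ∑ w ∈ J, w - x * ((J.card : ℂ) + ∑ w ∈ A, (1 - w)) := by
  rw [Finset.sum_sub_distrib, Finset.sum_sub_distrib, Finset.sum_sub_distrib, ← Finset.mul_sum,
    ← Finset.mul_sum]
  simp only [Finset.sum_const, nsmul_eq_mul]
  ring

/-- By `balance_eq` and `weight_ne_zero` each pair (A, J) is balanced for at most one position of
the scaled point, once around either gon. Together with the equality of radii this forbids finitely
many `t`. -/
theorem exists_unbalanced_scaling {m : ℕ} (hm : 0 < m) {x y : ℂ} (hx : x ≠ 0) (hy : y ≠ 0)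
    {ε : ℝ} (hε : 0 < ε) : ∃ t : ℝ, 0 < t ∧ t < ε ∧ ‖x‖ ≠ ‖((1 + t : ℝ) : ℂ) * y‖ ∧
      Unbalanced m x (((1 + t : ℝ) : ℂ) * y) ∧ Unbalanced m (((1 + t : ℝ) : ℂ) * y) x := by
  let R := (nthRootsFinset m (1 : ℂ)).powerset ×ˢ (nthRootsFinset m (1 : ℂ)).powerset
  let κ : Finset ℂ × Finset ℂ → ℂ := fun p => (p.2.card : ℂ) + ∑ w ∈ p.1, (1 - w)
  let B : Finset ℂ := (R.image fun p => x * κ p / ∑ w ∈ p.2, w) ∪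
    R.image fun p => x * (∑ w ∈ p.2, w) / κ p
  have hinj : Function.Injective fun t : ℝ => ((1 + t : ℝ) : ℂ) * y := fun s t h => by
    have := mul_right_cancel₀ hy h
    simpa using this
  have hfin : ((fun t : ℝ => ((1 + t : ℝ) : ℂ) * y) ⁻¹' B ∪ {‖x‖ / ‖y‖ - 1}).Finite :=
    (B.finite_toSet.preimage hinj.injOn).union (Set.finite_singleton _)
  obtain ⟨t, ⟨ht0, htε⟩, ht⟩ := ((Set.Ioo_infinite hε).sdiff hfin).nonempty
  simp only [Set.mem_union, Set.mem_preimage, Finset.mem_coe, Set.mem_singleton_iff, not_or] at ht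
  obtain ⟨htB, htn⟩ := ht
  have hmem : ∀ A J : Finset ℂ, (∀ w ∈ A, w ^ m = 1) → (∀ w ∈ J, w ^ m = 1) → (A, J) ∈ R := by
    intro A J hA hJ
    simp only [R, Finset.mem_product, Finset.mem_powerset]
    exact ⟨fun w hw => (mem_roots hm).2 (hA w hw), fun w hw => (mem_roots hm).2 (hJ w hw)⟩
  refine ⟨t, ht0, htε, ?_, ?_, ?_⟩
  · intro h
    apply htn
    rw [norm_mul, Complex.norm_real, Real.norm_of_nonneg (by linarith)] at h
    rw [h, mul_div_cancel_right₀ _ (norm_ne_zero_iff.2 hy)]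
    ring
  · intro A J hA hJ hne h0
    have hκ := weight_ne_zero hm hA hne
    rw [balance_eq, sub_eq_zero] at h0
    have hS : ∑ w ∈ J, w ≠ 0 := by
      intro hS
      rw [hS, mul_zero] at h0
      exact mul_ne_zero hx hκ h0.symm
    exact htB (Finset.mem_union_left _ (Finset.mem_image.2 ⟨(A, J), hmem A J hA hJ,
      by rw [div_eq_iff hS]; exact h0.symm⟩))
  · intro A J hA hJ hne h0
    have hκ := weight_ne_zero hm hA hne
    rw [balance_eq, sub_eq_zero] at h0
    exact htB (Finset.mem_union_right _ (Finset.mem_image.2 ⟨(A, J), hmem A J hA hJ,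
      by rw [div_eq_iff hκ]; exact h0⟩))

/-- The vector sum of the visible points is fixed by every rotation that preserves the view. -/
theorem eq_one_of_view_eq {S : Type*} [Fintype S] {m : ℕ} (hm : 0 < m) {b : S → ℂ}
    (hb : Function.Injective (orb m b)) {s : S} {u : Circle}
    (h : view (orb m b) (s, oneRoot hm) = u • view (orb m b) (s, oneRoot hm))
    (h0 : ∑ s', ∑ w ∈ visible m (b s') (b s), (b s' * w - b s) ≠ 0) : u = 1 := by
  have h1 := sum_of_view_eq hb hb h fun z => z
  simp only [orb_oneRoot] at h1
  rw [← Finset.mul_sum, sum_visible b (b s) fun z => z] at h1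
  apply Circle.ext
  rw [Circle.coe_one]
  exact mul_right_cancel₀ h0 (by rw [← h1, one_mul])

theorem eq_of_view_eq {m : ℕ} (hm : 0 < m) {b : Bool → ℂ} (hb : Function.Injective (orb m b))
    (hnorm : ‖b true‖ ≠ ‖b false‖) (hu₁ : Unbalanced m (b true) (b false))
    (hu₂ : Unbalanced m (b false) (b true))
    (hvis : ∀ s, ∃ j, orb m b j ≠ b s ∧ ‖orb m b j - b s‖ ≤ 1)
    (hconn : (∃ w ∈ visible m (b true) (b true), w ≠ 1) ∨
      (∃ w ∈ visible m (b false) (b false), w ≠ 1) ∨ 2 ≤ (visible m (b false) (b true)).card)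
    {s s' : Bool} {u : Circle}
    (h : view (orb m b) (s, oneRoot hm) = u • view (orb m b) (s', oneRoot hm)) :
    s = s' ∧ u = 1 := by
  have hroot : ∀ a b w, w ∈ visible m a b → w ^ m = 1 := fun a b w hw =>
    (mem_roots hm).1 (Finset.mem_filter.1 hw).1
  have hne : ∀ s, (∃ w ∈ visible m (b s) (b s), w ≠ 1) ∨ (visible m (b !s) (b s)).Nonempty := by
    intro s
    obtain ⟨⟨s', w⟩, hj, hj1⟩ := hvis s
    by_cases hs : s' = s
    · subst hs
      refine Or.inl ⟨w, Finset.mem_filter.2 ⟨w.2, hj1⟩, fun hw => hj ?_⟩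
      simp [orb, hw]
    · have : s' = !s := by cases s <;> cases s' <;> simp_all
      subst this
      exact Or.inr ⟨w, Finset.mem_filter.2 ⟨w.2, hj1⟩⟩
  have hsum' : ∀ f : ℂ → ℂ,
      ∑ r, ∑ w ∈ visible m (b r) (b s), f (b r * w - b s) =
      ∑ r, ∑ w ∈ visible m (b r) (b s'), f (u * (b r * w - b s')) := by
    intro f
    have h1 := sum_of_view_eq hb hb h f
    simp only [orb_oneRoot] at h1
    rw [sum_visible b (b s) f] at h1
    rw [h1]
    exact sum_visible b (b s') fun z => f (u * z)
  simp only [Fintype.sum_bool] at hsum'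
  -- The hypotheses are symmetric in the two gons; if the radii are in the other order, the
  -- comparison is made with the inverse rotation.
  have hfalse : ∀ v : Circle, ¬ ∀ f : ℂ → ℂ,
      ∑ w ∈ visible m (b true) (b true), f (b true * w - b true) +
        ∑ w ∈ visible m (b false) (b true), f (b false * w - b true) =
      ∑ w ∈ visible m (b true) (b false), f (v * (b true * w - b false)) +
        ∑ w ∈ visible m (b false) (b false), f (v * (b false * w - b false)) := by
    intro v hv
    rcases lt_or_gt_of_ne hnorm with hlt | hlt
    · refine false_of_matching_views hm hlt (u := v) (fun f => ?_) hconn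
      rw [hv f, add_comm]
    · refine false_of_matching_views hm hlt (u := v⁻¹) (fun f => ?_) ?_
      · have h1 := hv fun z => f ((v⁻¹ : Circle) * z)
        simp only [Circle.coe_inv, inv_mul_cancel_left₀ (Circle.coe_ne_zero v)] at h1 ⊢
        rw [h1, add_comm]
      · rw [card_visible_swap hm]
        rcases hconn with h1 | h1 | h1
        · exact Or.inr (Or.inl h1)
        · exact Or.inl h1
        · exact Or.inr (Or.inr h1)
  cases s <;> cases s'
  · refine ⟨rfl, eq_one_of_view_eq hm hb h ?_⟩
    rw [Fintype.sum_bool, add_comm]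
    exact hu₂ _ _ (hroot _ _) (hroot _ _) (hne false)
  · refine (hfalse u⁻¹ fun f => ?_).elim
    have h1 := hsum' fun z => f ((u⁻¹ : Circle) * z)
    simp only [Circle.coe_inv, inv_mul_cancel_left₀ (Circle.coe_ne_zero u)] at h1 ⊢
    exact h1.symm
  · exact (hfalse u fun f => hsum' f).elim
  · refine ⟨rfl, eq_one_of_view_eq hm hb h ?_⟩
    rw [Fintype.sum_bool]
    exact hu₁ _ _ (hroot _ _) (hroot _ _) (hne true)

/-! ### Connected patterns of one or two polygons -/

theorem exists_edge {P : Finset ℂ} (hconn : (unitDiscGraph P).Connected) (T : Set ℂ) {x y : ℂ}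
    (hx : x ∈ P) (hxT : x ∈ T) (hy : y ∈ P) (hyT : y ∉ T) :
    ∃ x' ∈ P, ∃ y' ∈ P, x' ∈ T ∧ y' ∉ T ∧ ‖y' - x'‖ ≤ 1 := by
  obtain ⟨walk⟩ := hconn.preconnected ⟨x, hx⟩ ⟨y, hy⟩
  obtain ⟨d, -, h1, h2⟩ := walk.exists_boundary_dart (Subtype.val ⁻¹' T) hxT hyT
  refine ⟨d.fst, d.fst.2, d.snd, d.snd.2, h1, h2, ?_⟩
  rw [← dist_eq_norm, dist_comm]
  exact d.adj.2

theorem exists_neighbor {P : Finset ℂ} (hconn : (unitDiscGraph P).Connected) (hP : 2 ≤ P.card)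
    {x : ℂ} (hx : x ∈ P) : ∃ y ∈ P, y ≠ x ∧ ‖y - x‖ ≤ 1 := by
  obtain ⟨z, hz, hzx⟩ := Finset.exists_mem_ne (s := P) (by omega) x
  obtain ⟨x', -, y, hy, rfl, hyx, h⟩ := exists_edge hconn {x} hx rfl hz hzx
  exact ⟨y, hy, hyx, h⟩

theorem norm_mul_sub_root {m : ℕ} (hm : 0 < m) {v w : ℂ} (hv : v ^ m = 1) (x y : ℂ) :
    ‖y * w - x * v‖ = ‖y * (w / v) - x‖ := by
  have hn := norm_of_pow_eq_one hm hv
  have hv0 : v ≠ 0 := norm_ne_zero_iff.1 (by rw [hn]; exact one_ne_zero)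
  have h : y * w - x * v = (y * (w / v) - x) * v := by field_simp
  rw [h, norm_mul, hn, mul_one]

/-- No perturbation is needed: the points seen from a vertex of a regular polygon pull strictly
towards the center, so the view has no rotational symmetry. -/
theorem canBeFormed_of_one_gon {P : Finset ℂ} (hconn : (unitDiscGraph P).Connected)
    (hP : 2 ≤ P.card) {m : ℕ} (hm : 0 < m) (hmP : symmetricity P = m) (hcard : P.card = m)
    {c a : ℂ} (ha : a ≠ 0) (h : ∀ x, x ∈ P ↔ ∃ w : ℂ, w ^ m = 1 ∧ x = c + a * w) :
    CanBeFormed P := by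
  have ha' : 0 < ‖a‖ := norm_pos_iff.2 ha
  have hinj : ∀ {a : ℂ}, a ≠ 0 → Function.Injective (orb m fun _ : Unit => a) := by
    rintro a ha ⟨_, w⟩ ⟨_, v⟩ h
    exact Prod.ext rfl (Subtype.ext (mul_left_cancel₀ ha h))
  have hv : ∀ s : Unit, ∃ j, orb m (fun _ : Unit => a) j ≠ a ∧
      ‖orb m (fun _ : Unit => a) j - a‖ ≤ 1 := by
    intro s
    obtain ⟨y, hy, hne, hd⟩ := exists_neighbor hconn hP
      ((h (c + a)).2 ⟨1, one_pow m, by rw [mul_one]⟩)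
    obtain ⟨w, hw, rfl⟩ := (h y).1 hy
    refine ⟨((), ⟨w, (mem_roots hm).2 hw⟩), fun h => hne ?_, ?_⟩
    · simp only [orb] at h
      rw [h]
    · simpa [orb] using hd
  -- The bound `c₁` is chosen so that c > c₁ gives (1 - c) |a| ≤ 1, the length of the last step.
  refine canBeFormed_of_generic hP hm hmP (S := Unit) (a := fun _ => a) (b := fun _ => a)
    (c₁ := ‖a‖ / (1 + ‖a‖)) (c₀ := 1) (by simp [hcard]) ⟨c, ?_⟩ (fun _ => ha) (hinj ha)
    (by positivity) ?_ ?_ hv (by simpa using hv) ?_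
  · ext x
    rw [Finset.mem_coe, h]
    constructor
    · rintro ⟨w, hw, rfl⟩
      exact ⟨((), ⟨w, (mem_roots hm).2 hw⟩), by simp only [orb]; ring⟩
    · rintro ⟨⟨_, w⟩, rfl⟩
      exact ⟨w, (mem_roots hm).1 w.2, by simp only [orb]; ring⟩
  · rw [div_lt_one (by positivity)]
    linarith
  · intro t ht1 ht0 _
    rw [div_lt_iff₀ (by positivity)] at ht1
    have h1 : a - t * a = ((1 - t : ℝ) : ℂ) * a := by push_cast; ring
    rw [h1, norm_mul, Complex.norm_real, Real.norm_of_nonneg (by linarith)]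
    nlinarith
  · rintro t ht0 ht1 ⟨⟩ ⟨⟩ u hu
    have ht : (t : ℂ) ≠ 0 := by exact_mod_cast ht0.ne'
    refine ⟨rfl, eq_one_of_view_eq hm (hinj (mul_ne_zero ht ha)) hu ?_⟩
    obtain ⟨⟨_, w⟩, hw, hw1⟩ := hv ()
    have hmem : (w : ℂ) ∈ visible m (t * a) (t * a) := by
      refine Finset.mem_filter.2 ⟨w.2, ?_⟩
      rw [mul_assoc, ← mul_sub, norm_mul, Complex.norm_real, Real.norm_of_nonneg ht0.le]
      exact mul_le_one₀ ht1 (norm_nonneg _) hw1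
    have hne : (w : ℂ) ≠ 1 := by
      intro h1
      apply hw
      simp [orb, h1]
    have h1 := weight_ne_zero (A := visible m (t * a) (t * a)) (J := ∅) hm
      (fun w hw => (mem_roots hm).1 (Finset.mem_filter.1 hw).1) (Or.inl ⟨_, hmem, hne⟩)
    have h2 := balance_eq (x := t * a) (y := 0) (visible m (t * a) (t * a)) ∅
    rw [Finset.sum_empty, add_zero, zero_mul, zero_sub] at h2
    rw [Finset.univ_unique, Finset.sum_singleton, h2]
    exact neg_ne_zero.2 (mul_ne_zero (mul_ne_zero ht ha) h1)

/-- In a connected pattern of two regular `m`-gons there are neighbors in the same `m`-gon, or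
a point has two neighbors in the other `m`-gon. -/
theorem exists_second_neighbor {P : Finset ℂ} (hconn : (unitDiscGraph P).Connected) {m : ℕ}
    (hm : 0 < m) (hP : 2 < P.card) {c a b : ℂ}
    (h : ∀ x, x ∈ P ↔ ∃ w : ℂ, w ^ m = 1 ∧ (x = c + a * w ∨ x = c + b * w)) :
    (∃ w ∈ visible m a a, w ≠ 1) ∨ (∃ w ∈ visible m b b, w ≠ 1) ∨ 2 ≤ (visible m b a).card := by
  have hmem : ∀ x y w : ℂ, w ^ m = 1 → ‖y * w - x‖ ≤ 1 → w ∈ visible m y x := fun x y w hw hd =>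
    Finset.mem_filter.2 ⟨(mem_roots hm).2 hw, hd⟩
  have hroot : ∀ {v w : ℂ}, v ^ m = 1 → w ^ m = 1 → (w / v) ^ m = 1 := fun hv hw => by
    rw [div_pow, hv, hw, div_one]
  have hne0 : ∀ {v : ℂ}, v ^ m = 1 → v ≠ 0 := fun hv =>
    norm_ne_zero_iff.1 (by rw [norm_of_pow_eq_one hm hv]; exact one_ne_zero)
  have hdiv : ∀ {v w : ℂ}, v ^ m = 1 → w / v = 1 → w = v := fun hv h1 =>
    (div_eq_one_iff_eq (hne0 hv)).1 h1
  have haP : c + a ∈ P := (h _).2 ⟨1, one_pow m, Or.inl (by rw [mul_one])⟩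
  obtain ⟨y, hy, hne, hd⟩ := exists_neighbor hconn hP.le haP
  obtain ⟨v, hv, rfl | rfl⟩ := (h y).1 hy
  · refine Or.inl ⟨v, hmem _ _ _ hv (by rwa [add_sub_add_left_eq_sub] at hd), ?_⟩
    rintro rfl
    exact hne (by rw [mul_one])
  rw [add_sub_add_left_eq_sub] at hd
  -- Two adjacent points are not all of `P`, so some edge leaves the pair. Rotated suitably, it
  -- gives a neighbor in the same gon or a second neighbor of `c + a` in the other gon.
  have hcard : ({c + a, c + b * v} : Finset ℂ).card < P.card := Finset.card_le_two.trans_lt hP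
  obtain ⟨z, hz, hzT⟩ := Finset.exists_mem_notMem_of_card_lt_card hcard
  obtain ⟨x, -, y, hyP, hx, hyT, hxy⟩ := exists_edge hconn
    (({c + a, c + b * v} : Finset ℂ) : Set ℂ) haP (by simp) hz hzT
  simp only [Finset.coe_insert, Finset.coe_singleton, Set.mem_insert_iff, Set.mem_singleton_iff,
    not_or] at hx hyT
  have htwo : ∀ w, w ≠ v → w ∈ visible m b a → 2 ≤ (visible m b a).card := fun w hwv hw =>
    Finset.one_lt_card.2 ⟨w, hw, v, hmem _ _ _ hv hd, hwv⟩
  obtain ⟨w, hw, hy'⟩ := (h y).1 hyP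
  rcases hx with rfl | rfl <;> rcases hy' with rfl | rfl <;> rw [add_sub_add_left_eq_sub] at hxy
  · refine Or.inl ⟨w, hmem _ _ _ hw hxy, ?_⟩
    rintro rfl
    exact hyT.1 (by rw [mul_one])
  · refine Or.inr (Or.inr (htwo w ?_ (hmem _ _ _ hw hxy)))
    rintro rfl
    exact hyT.2 rfl
  · rw [norm_sub_rev, norm_mul_sub_root hm hw] at hxy
    refine Or.inr (Or.inr (htwo _ (fun h1 => hyT.1 ?_) (hmem _ _ _ (hroot hw hv) hxy)))
    rw [div_eq_iff (hne0 hw)] at h1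
    have h2 : w = 1 := mul_left_cancel₀ (hne0 hv) (by rw [← h1, mul_one])
    rw [h2, mul_one]
  · rw [norm_mul_sub_root hm hv] at hxy
    refine Or.inr (Or.inl ⟨_, hmem _ _ _ (hroot hv hw) hxy, fun h1 => hyT.2 ?_⟩)
    rw [hdiv hv h1]

/-- The two gons of `P` may have equal radii or balanced views, so the plan expands copies with `b`
scaled by 1 + t and corrects this in its last step. A further shrinking keeps the neighbors of `P`
visible. -/
theorem canBeFormed_of_two_gons {P : Finset ℂ} (hconn : (unitDiscGraph P).Connected)
    {m : ℕ} (hm2 : 2 ≤ m) (hmP : symmetricity P = m) (hcard : P.card = 2 * m)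
    {c a b : ℂ} (ha : a ≠ 0) (hb : b ≠ 0)
    (h : ∀ x, x ∈ P ↔ ∃ w : ℂ, w ^ m = 1 ∧ (x = c + a * w ∨ x = c + b * w)) :
    CanBeFormed P := by
  have hm : 0 < m := by omega
  have hP : 2 ≤ P.card := by omega
  have ha' := norm_nonneg a
  have hb' := norm_nonneg b
  set M := ‖a‖ + ‖b‖ with hMdef
  have hM : 0 < M := add_pos_of_pos_of_nonneg (norm_pos_iff.2 ha) hb'
  obtain ⟨t, ht0, htε, hnorm, hu₁, hu₂⟩ := exists_unbalanced_scaling hm ha hb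
    (ε := 1 / (8 * (M + 1) ^ 2)) (by positivity)
  rw [lt_div_iff₀ (by positivity)] at htε
  have htM : t * M < 1 / 8 := by nlinarith
  have htMM : t * M * M < 1 / 8 := by nlinarith
  have htM0 : 0 < t * M := mul_pos ht0 hM
  set b' : ℂ := ((1 + t : ℝ) : ℂ) * b with hb'def
  have hb'b : ‖b' - b‖ ≤ t * M := by
    have h1 : b' - b = (t : ℂ) * b := by rw [hb'def]; push_cast; ring
    rw [h1, norm_mul, Complex.norm_real, Real.norm_of_nonneg ht0.le]
    exact mul_le_mul_of_nonneg_left (by linarith) ht0.le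
  have ht1 : ((1 + t : ℝ) : ℂ) ≠ 0 := by
    rw [Ne, Complex.ofReal_eq_zero]
    linarith
  have hb'0 : b' ≠ 0 := mul_ne_zero ht1 hb
  let A : Bool → ℂ := fun s => cond s a b
  let B : Bool → ℂ := fun s => cond s a b'
  have hAB : ∀ s, ‖B s - A s‖ ≤ t * M := by
    rintro (_ | _)
    · exact hb'b
    · simpa [A, B] using htM0.le
  have hBM : ∀ s, ‖B s‖ ≤ M + t * M := by
    rintro (_ | _)
    · have := norm_add_le b (b' - b)
      rw [add_sub_cancel] at this
      simp only [B, cond_false]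
      linarith
    · simp only [B, cond_true]
      linarith
  have hB0 : ∀ s, B s ≠ 0 := by
    rintro (_ | _)
    · exact hb'0
    · exact ha
  have hwn : ∀ w : nthRootsFinset m (1 : ℂ), ‖(w : ℂ)‖ = 1 := fun w =>
    norm_of_pow_eq_one hm ((mem_roots hm).1 w.2)
  have hinj : ∀ {x y : ℂ}, x ≠ 0 → y ≠ 0 → ‖x‖ ≠ ‖y‖ →
      Function.Injective (orb m fun s => cond s x y) := by
    rintro x y hx hy hxy ⟨s, w⟩ ⟨s', v⟩ h
    have hn := congrArg norm h
    simp only [orb, norm_mul, hwn, mul_one] at hn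
    have hs : s = s' := by
      cases s <;> cases s' <;> simp_all
    subst hs
    have h0 : cond s x y ≠ 0 := by cases s <;> simpa
    exact Prod.ext rfl (Subtype.ext (mul_left_cancel₀ h0 h))
  have hBinj : Function.Injective (orb m B) := hinj ha hb'0 hnorm
  have hc₀ : 0 < 1 / (1 + 2 * (t * M)) := by positivity
  -- Each endpoint moves by at most t M under the perturbation; scaling by 1 / (1 + 2 t M) makes up
  -- for the longer edges.
  have hedge : ∀ i j, ‖orb m A i - orb m A j‖ ≤ 1 →
      ‖orb m B i - orb m B j‖ ≤ 1 + 2 * (t * M) := by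
    intro i j hij
    have h1 : ∀ i, ‖orb m B i - orb m A i‖ ≤ t * M := fun i => by
      simp only [orb, ← sub_mul]
      rw [norm_mul, hwn, mul_one]
      exact hAB i.1
    have h2 : orb m B i - orb m B j = (orb m A i - orb m A j) + (orb m B i - orb m A i) -
        (orb m B j - orb m A j) := by ring
    rw [h2]
    linarith [norm_sub_le ((orb m A i - orb m A j) + (orb m B i - orb m A i))
      (orb m B j - orb m A j), norm_add_le (orb m A i - orb m A j) (orb m B i - orb m A i),
      h1 i, h1 j]
  have hscale : ∀ (r : ℝ) (z : ℂ), 0 ≤ r → r ≤ 1 / (1 + 2 * (t * M)) →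
      ‖z‖ ≤ 1 + 2 * (t * M) → r * ‖z‖ ≤ 1 := by
    intro r z hr0 hr hz
    refine (mul_le_mul hr hz (norm_nonneg _) hc₀.le).trans_eq ?_
    exact one_div_mul_cancel (by positivity)
  have hmemP : ∀ s, c + A s ∈ P := by
    rintro (_ | _)
    · exact (h _).2 ⟨1, one_pow m, Or.inr (by rw [mul_one]; rfl)⟩
    · exact (h _).2 ⟨1, one_pow m, Or.inl (by rw [mul_one]; rfl)⟩
  have hva : ∀ s, ∃ j, orb m A j ≠ A s ∧ ‖orb m A j - A s‖ ≤ 1 := by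
    intro s
    obtain ⟨y, hy, hne, hd⟩ := exists_neighbor hconn hP (hmemP s)
    obtain ⟨w, hw, rfl | rfl⟩ := (h y).1 hy
    · refine ⟨(true, ⟨w, (mem_roots hm).2 hw⟩), fun h1 => hne ?_, ?_⟩
      · rw [← h1]
        rfl
      · rwa [add_sub_add_left_eq_sub] at hd
    · refine ⟨(false, ⟨w, (mem_roots hm).2 hw⟩), fun h1 => hne ?_, ?_⟩
      · rw [← h1]
        rfl
      · rwa [add_sub_add_left_eq_sub] at hd
  have hvb : ∀ s, ∃ j, orb m B j ≠ B s ∧ ‖orb m B j - B s‖ ≤ 1 + 2 * (t * M) := by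
    intro s
    obtain ⟨j, hj, hj1⟩ := hva s
    refine ⟨j, fun h1 => hj ?_, ?_⟩
    · rw [← orb_oneRoot hm B s] at h1
      rw [hBinj h1, orb_oneRoot]
    · rw [← orb_oneRoot hm A s] at hj1
      have := hedge _ _ hj1
      rwa [orb_oneRoot] at this
  -- The interval for `c` is non-empty because (1 - 3 t M) (1 + 2 t M) < 1. For c in it the last
  -- step is at most 3 t M (M + t M) + t M, which is below 1 as t M and t M² are below 1/8.
  refine canBeFormed_of_generic hP hm hmP (S := Bool) (a := A) (b := B)
    (c₁ := 1 - 3 * (t * M)) (c₀ := 1 / (1 + 2 * (t * M))) (by simp [hcard]) ⟨c, ?_⟩ hB0 hBinj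
    (by linarith) ?_ ?_ hva ?_ ?_
  · ext x
    rw [Finset.mem_coe, h]
    constructor
    · rintro ⟨w, hw, rfl | rfl⟩
      · exact ⟨(true, ⟨w, (mem_roots hm).2 hw⟩), by simp only [orb, A, cond_true]; ring⟩
      · exact ⟨(false, ⟨w, (mem_roots hm).2 hw⟩), by simp only [orb, A, cond_false]; ring⟩
    · rintro ⟨⟨_ | _, w⟩, rfl⟩
      · exact ⟨w, (mem_roots hm).1 w.2, Or.inr (by simp only [orb, A, cond_false]; ring)⟩
      · exact ⟨w, (mem_roots hm).1 w.2, Or.inl (by simp only [orb, A, cond_true]; ring)⟩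
  · rw [lt_div_iff₀ (by positivity)]
    nlinarith
  · intro r hr1 hr0 s
    have hr : r ≤ 1 := hr0.le.trans (by rw [div_le_one (by positivity)]; linarith)
    have h1 : A s - r * B s = ((1 - r : ℝ) : ℂ) * B s - (B s - A s) := by push_cast; ring
    have h2 : ‖((1 - r : ℝ) : ℂ) * B s‖ ≤ 3 * (t * M) * (M + t * M) := by
      rw [norm_mul, Complex.norm_real, Real.norm_of_nonneg (by linarith)]
      exact mul_le_mul (by linarith) (hBM s) (norm_nonneg _) (by linarith)
    rw [h1]
    have h3 := norm_sub_le (((1 - r : ℝ) : ℂ) * B s) (B s - A s)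
    have h4 := hAB s
    nlinarith
  · intro s
    obtain ⟨j, hj, hj1⟩ := hvb s
    exact ⟨j, hj, hscale _ _ hc₀.le le_rfl hj1⟩
  · intro r hr0 hr s s' u hu
    have hr0' : (r : ℂ) ≠ 0 := by exact_mod_cast hr0.ne'
    have hrn : ∀ z : ℂ, ‖(r : ℂ) * z‖ = r * ‖z‖ := fun z => by
      rw [norm_mul, Complex.norm_real, Real.norm_of_nonneg hr0.le]
    have horb : ∀ j, orb m (fun s => (r : ℂ) * B s) j = r * orb m B j := fun j => mul_assoc _ _ _
    have hvis : ∀ i i' w, w ∈ visible m (A i) (A i') → w ∈ visible m (r * B i) (r * B i') := by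
      intro i i' w hw
      obtain ⟨hw1, hw2⟩ := Finset.mem_filter.1 hw
      refine Finset.mem_filter.2 ⟨hw1, ?_⟩
      rw [mul_assoc, ← mul_sub, hrn]
      refine hscale r _ hr0.le hr ?_
      have h1 := hedge (i, ⟨w, hw1⟩) (i', oneRoot hm) (by rw [orb_oneRoot]; exact hw2)
      rwa [orb_oneRoot] at h1
    have hu₁' : Unbalanced m (r * B true) (r * B false) := Unbalanced.scale hu₁ hr0'
    have hu₂' : Unbalanced m (r * B false) (r * B true) := Unbalanced.scale hu₂ hr0'
    refine eq_of_view_eq (b := fun s => (r : ℂ) * B s) hm ?_ ?_ hu₁' hu₂' ?_ ?_ hu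
    · intro i j hij
      rw [horb, horb] at hij
      exact hBinj (mul_left_cancel₀ hr0' hij)
    · rw [hrn, hrn]
      exact fun h1 => hnorm (mul_left_cancel₀ hr0.ne' h1)
    · intro s
      obtain ⟨j, hj, hj1⟩ := hvb s
      refine ⟨j, fun h1 => hj (mul_left_cancel₀ hr0' (by rw [← h1, horb])), ?_⟩
      rw [horb, ← mul_sub, hrn]
      exact hscale r _ hr0.le hr hj1
    · rcases exists_second_neighbor hconn hm (by omega) h with ⟨w, hw, h1⟩ | ⟨w, hw, h1⟩ | h2
      · exact Or.inl ⟨w, hvis true true w hw, h1⟩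
      · exact Or.inr (Or.inl ⟨w, hvis false false w hw, h1⟩)
      · have h3 : visible m b a ⊆ visible m (r * B false) (r * B true) := fun w hw =>
          hvis false true w hw
        exact Or.inr (Or.inr (h2.trans (Finset.card_le_card h3)))

theorem canBeFormed_of_card_eq_one {P : Finset ℂ} (hP : P.card = 1) : CanBeFormed P := by
  refine ⟨⟨fun _ => 0, by simp⟩, fun p _ _ u => ⟨0, ?_, fun t _ => ?_⟩⟩
  · obtain ⟨x, rfl⟩ := Finset.card_eq_one.1 hP
    have hp : p = fun _ => p ⟨0, by simp⟩ := by
      funext i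
      congr 1
      exact Fin.ext (by have := i.2; simp only [Finset.card_singleton] at this; simp; omega)
    have hne : Nonempty (Fin ({x} : Finset ℂ).card) := ⟨⟨0, by simp⟩⟩
    refine ⟨1, p ⟨0, by simp⟩ - x, ?_⟩
    rw [Protocol.run, hp, Set.range_const]
    simp
  · induction t with
    | zero => rfl
    | succ t ih =>
      refine Eq.trans ?_ (ih (Nat.zero_le t))
      funext i
      simp [Protocol.run, Protocol.step]

end PatternFormation

end

theorem mainTheorem4 (P : Finset ℂ) (hconn : (PatternFormation.unitDiscGraph P).Connected)
    (hsym : (P.card : ℝ) / 2 ≤ (PatternFormation.symmetricity P : ℝ)) :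
    PatternFormation.CanBeFormed P := by
  obtain ⟨x⟩ := hconn.nonempty
  have hne : P.Nonempty := ⟨x, x.2⟩
  have hpos := hne.card_pos
  by_cases h1 : P.card = 1
  · exact PatternFormation.canBeFormed_of_card_eq_one h1
  have hle : P.card ≤ 2 * PatternFormation.symmetricity P := by
    have : (P.card : ℝ) ≤ 2 * (PatternFormation.symmetricity P : ℝ) := by linarith
    exact_mod_cast this
  have hm : 2 ≤ PatternFormation.symmetricity P := by
    -- For two points the hypothesis yields only m ≥ 1, but such a pair is a 2-gon about its
    -- midpoint.
    by_cases h2 : P.card = 2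
    · exact PatternFormation.two_le_symmetricity_of_card_eq_two h2
    · omega
  obtain ⟨c, ⟨a, ha, hcard, h⟩ | ⟨a, b, ha, hb, hcard, h⟩⟩ :=
    PatternFormation.exists_orbits hne hm hle
  · exact PatternFormation.canBeFormed_of_one_gon hconn (by omega) (by omega) rfl hcard ha h
  · exact PatternFormation.canBeFormed_of_two_gons hconn hm rfl hcard ha hb h
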